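/- Let $\mathbb R\langle x\rangle$ be the algebra of real polynomials in $g$ freely non-commuting variables $x=(x_1,\dots,x_g)$, with the involution $*$ that is the identity on scalars and satisfies $x_j^*=x_j$ and $(fh)^*=h^*f^*$. For $n\in\mathbb N$ let $\mathbb S_n$ be the space of real symmetric $n\times n$ matrices and $\mathbb S_n(\mathbb R^g)$ the space of $g$-tuples $X=(X_1,\dots,X_g)$ of matrices in $\mathbb S_n$; $f(X)$ denotes the evaluation of a polynomial $f$ at $X$, and $\succ 0$ and $\succeq 0$ mean positive definite and positive semidefinite. Call $f$ a (hermitian) sum of squares if $f=\sum_{j=1}^m h_j^*h_j$ for finitely many $h_j\in\mathbb R\langle x\rangle$, and call $f$ linear if it is a real linear combination of $x_1,\dots,x_g$. Let $p\in\mathbb R\langle x\rangle$ be quasi-convex, that is, $p=p^*$, $p(0)=0$, and for every $n$ and every positive definite $A\in\mathbb S_n$ the set $\{X\in\mathbb S_n(\mathbb R^g): A-p(X)\succ 0\}$ is convex. Then: 1. Either $-p$ is a sum of squares, or $p$ has degree at most $2$ and there are a linear polynomial $\ell$ and finitely many linear polynomials $s_1,\dots,s_m$ with $$p=\ell+\sum_{j=1}^m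 s_j^*s_j .$$ (The two alternatives are not claimed to exclude each other.) 2. If there is an $N$ such that for each $n\ge N$ there is a $B\in\mathbb S_n$ with $B\not\succeq 0$ for which $\{X\in\mathbb S_n(\mathbb R^g): B-p(X)\succ 0\}$ is convex, then $-p$ is a sum of squares if and only if $p=0$. -/

import Mathlib

noncomputable section

namespace FreePoly

/-- Free polynomials over `ℝ` in the freely non-commuting variables `x_1, …, x_g`. Mathlib's `star`
on `FreeAlgebra` is the involution which fixes every variable and every scalar and reverses
products. -/
abbrev Poly (g : ℕ) : Type := FreeAlgebra ℝ (Fin g)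

/-- The `g`-tuples of real symmetric `n × n` matrices. -/
def symTuples (g n : ℕ) : Set (Fin g → Matrix (Fin n) (Fin n) ℝ) :=
  {X | ∀ j, (X j).IsSymm}

/-- The evaluation `p(X)` of a free polynomial at a tuple of matrices. -/
def eval {g n : ℕ} (X : Fin g → Matrix (Fin n) (Fin n) ℝ) (p : Poly g) :
    Matrix (Fin n) (Fin n) ℝ :=
  FreeAlgebra.lift ℝ X p

/-- The set `{X : A - p(X) ≻ 0}` of tuples of symmetric matrices. -/
def levelSet {g n : ℕ} (p : Poly g) (A : Matrix (Fin n) (Fin n) ℝ) :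
    Set (Fin g → Matrix (Fin n) (Fin n) ℝ) :=
  {X | X ∈ symTuples g n ∧ (A - eval X p).PosDef}

/-- A free polynomial `p` is quasi-convex if it is symmetric, `p(0) = 0`, and `{X : A - p(X) ≻ 0}`
is convex for every positive definite matrix `A` of every size. -/
structure IsQuasiConvex {g : ℕ} (p : Poly g) : Prop where
  symmetric : star p = p
  eval_zero : ∀ n : ℕ, eval (0 : Fin g → Matrix (Fin n) (Fin n) ℝ) p = 0
  convex : ∀ (n : ℕ) (A : Matrix (Fin n) (Fin n) ℝ), A.PosDef → Convex ℝ (levelSet p A)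

/-- Hermitian sums of squares `∑ h_j^* h_j`. -/
def IsHermitianSOS {g : ℕ} (p : Poly g) : Prop :=
  ∃ (m : ℕ) (h : Fin m → Poly g), p = ∑ j, star (h j) * h j

/-- Linear polynomials: the real linear combinations of the variables (no constant term). -/
def IsLinear {g : ℕ} (p : Poly g) : Prop :=
  p ∈ Submodule.span ℝ (Set.range (FreeAlgebra.ι ℝ : Fin g → Poly g))

/-- The degree of a free polynomial: the largest length of a word with nonzero coefficient
(and `0` for the zero polynomial). -/
def degree {g : ℕ} (p : Poly g) : ℕ :=
  (FreeAlgebra.equivMonoidAlgebraFreeMonoid (R := ℝ) (X := Fin g) p).coeff.support.sup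
    FreeMonoid.length

end FreePoly

end

/-!
If `-p` is not a sum of squares, separate it from the cone of sums of squares by a linear
functional which is strictly positive on nonzero squares; the GNS construction turns the
functional into a tuple `X` of symmetric matrices and a vector `v`, separating for polynomials of
low degree, such that `⟨v, p(X) v⟩ > 0`. Border `X` by one row and column `t b`. Quasi-convexity,
tested with matrices `A` which are huge away from `v ⊕ 0`, gives quasi-convexity of the scalar
function `⟨v, p(·) v⟩` at positive levels, so its second order term along `±t b` is nonnegative.
As `v` is separating, the borders `b` reach every vector of the middle matrix of the Hessian of
`p`, which is therefore positive semidefinite. A zero on its diagonal then kills all coefficients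
of degree at least three, and the square root of the quadratic part provides the `s_j`.

For the second part let `-p = ∑ h_j^* h_j ≠ 0`. The leading part of a nonconstant `h_k` takes an
invertible value at some symmetric tuple `X`: expand the entries of a tuple where it does not
vanish in products of Pauli matrices, scaled by independent parameters; the value becomes a
polynomial in the parameters all of whose coefficients are invertible or zero, and on a suitable
monomial curve one of its terms dominates. Then `B - p(±s⁻¹ X) ≻ 0` for small `s`, and convexity
at the midpoint `0` forces `B ≻ 0`.
-/

noncomputable section

namespace FreePoly

open Matrix Filter Topology

variable {g : ℕ}

section Words

/-- The monomial attached to a word in the variables. -/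
def word (l : List (Fin g)) : Poly g := (l.map (FreeAlgebra.ι ℝ)).prod

@[simp] theorem word_nil : word ([] : List (Fin g)) = 1 := rfl

@[simp] theorem word_cons (j : Fin g) (l : List (Fin g)) :
    word (j :: l) = FreeAlgebra.ι ℝ j * word l := by
  simp [word]

theorem word_append (l m : List (Fin g)) : word (l ++ m) = word l * word m := by
  simp [word]

theorem star_word (l : List (Fin g)) : star (word l) = word l.reverse := by
  induction l with
  | nil => simp
  | cons j l ih => simp [word_append, ih]

theorem star_smul_poly (c : ℝ) (q : Poly g) : star (c • q) = c • star q := by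
  rw [Algebra.smul_def, star_mul, FreeAlgebra.star_algebraMap, Algebra.smul_def,
    Algebra.commutes]

/-- The coefficient of a word in a free polynomial. -/
def coef (l : List (Fin g)) : Poly g →ₗ[ℝ] ℝ where
  toFun p := (FreeAlgebra.equivMonoidAlgebraFreeMonoid (R := ℝ) (X := Fin g) p).coeff
    (FreeMonoid.ofList l)
  map_add' p q := by simp
  map_smul' c p := by simp

theorem poly_ext {p q : Poly g} (h : ∀ l, coef l p = coef l q) : p = q := by
  apply (FreeAlgebra.equivMonoidAlgebraFreeMonoid (R := ℝ) (X := Fin g)).injective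
  ext l
  exact h l.toList

theorem equivMonoidAlgebra_word (l : List (Fin g)) :
    FreeAlgebra.equivMonoidAlgebraFreeMonoid (R := ℝ) (X := Fin g) (word l) =
      MonoidAlgebra.single (FreeMonoid.ofList l) 1 := by
  induction l with
  | nil => simp [MonoidAlgebra.one_def]
  | cons j l ih =>
    rw [word_cons, map_mul, ih, FreeMonoid.ofList_cons]
    simp [FreeAlgebra.equivMonoidAlgebraFreeMonoid, MonoidAlgebra.of_apply,
      MonoidAlgebra.single_mul_single]

theorem coef_word (l m : List (Fin g)) : coef l (word m) = if l = m then 1 else 0 := by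
  classical
  simp only [coef, LinearMap.coe_mk, AddHom.coe_mk, equivMonoidAlgebra_word,
    MonoidAlgebra.coeff_single, Finsupp.single_apply, FreeMonoid.ofList.injective.eq_iff,
    eq_comm]

theorem degree_le_iff {p : Poly g} {L : ℕ} :
    degree p ≤ L ↔ ∀ l : List (Fin g), L < l.length → coef l p = 0 := by
  refine Finset.sup_le_iff.trans (forall_congr' fun l => ?_)
  rw [Finsupp.mem_support_iff, not_imp_comm, not_le]
  exact Iff.rfl

theorem coef_eq_zero_of_degree_lt {p : Poly g} {l : List (Fin g)} (h : degree p < l.length) :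
    coef l p = 0 :=
  degree_le_iff.1 le_rfl l h

theorem exists_coef_ne_zero_length_eq_degree {p : Poly g} (hp : p ≠ 0) :
    ∃ l : List (Fin g), coef l p ≠ 0 ∧ l.length = degree p := by
  have hne : (FreeAlgebra.equivMonoidAlgebraFreeMonoid (R := ℝ) (X := Fin g)
      p).coeff.support.Nonempty := by
    rw [Finset.nonempty_iff_ne_empty, Ne, Finsupp.support_eq_empty]
    exact fun h => hp (poly_ext fun l => by
      rw [map_zero]; exact DFunLike.congr_fun h (FreeMonoid.ofList l))
  obtain ⟨l, hl, hd⟩ := Finset.exists_mem_eq_sup _ hne FreeMonoid.length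
  exact ⟨l.toList, Finsupp.mem_support_iff.1 hl, hd.symm⟩

/-- The words of length at most `L`; they index the monomial basis of the polynomials of degree at
most `L`. -/
abbrev Words (g L : ℕ) : Type := {l : List (Fin g) // l.length ≤ L}

instance (L : ℕ) : Fintype (Words g L) :=
  (List.finite_length_le (Fin g) L).fintype

/-- The empty word. -/
def Words.nil (g L : ℕ) : Words g L := ⟨[], Nat.zero_le L⟩

/-- The polynomial with a given vector of coefficients. -/
def polyOf {L : ℕ} : (Words g L → ℝ) →ₗ[ℝ] Poly g :=
  Fintype.linearCombination ℝ fun a => word a.1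

/-- The vector of the coefficients of a polynomial at the words of length at most `L`. -/
def coefVec (L : ℕ) : Poly g →ₗ[ℝ] (Words g L → ℝ) :=
  LinearMap.pi fun a => coef a.1

theorem polyOf_apply {L : ℕ} (x : Words g L → ℝ) : polyOf x = ∑ a, x a • word a.1 := rfl

theorem coefVec_apply {L : ℕ} (q : Poly g) (a : Words g L) : coefVec L q a = coef a.1 q := rfl

theorem coef_polyOf {L : ℕ} (x : Words g L → ℝ) (l : List (Fin g)) :
    coef l (polyOf x) = if h : l.length ≤ L then x ⟨l, h⟩ else 0 := by
  simp only [polyOf_apply, map_sum, map_smul, coef_word, smul_eq_mul, mul_ite, mul_one, mul_zero]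
  split_ifs with h
  · rw [Finset.sum_eq_single ⟨l, h⟩ (fun a _ ha => if_neg fun hl => ha (Subtype.ext hl.symm))
      (by simp), if_pos rfl]
  · exact Finset.sum_eq_zero fun a _ => if_neg fun hl => h (by rw [hl]; exact a.2)

theorem degree_polyOf_le {L : ℕ} (x : Words g L → ℝ) : degree (polyOf x) ≤ L :=
  degree_le_iff.2 fun l hl => by rw [coef_polyOf, dif_neg hl.not_ge]

theorem coefVec_polyOf {L : ℕ} (x : Words g L → ℝ) : coefVec L (polyOf x) = x := by
  ext a
  rw [coefVec_apply, coef_polyOf, dif_pos a.2]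

theorem polyOf_coefVec {L : ℕ} {q : Poly g} (hq : degree q ≤ L) : polyOf (coefVec L q) = q := by
  refine poly_ext fun l => ?_
  rw [coef_polyOf]
  split_ifs with h
  · rfl
  · exact (degree_le_iff.1 hq l (not_le.1 h)).symm

theorem sum_coef_word {L : ℕ} {q : Poly g} (hq : degree q ≤ L) :
    ∑ a : Words g L, coef a.1 q • word a.1 = q :=
  polyOf_coefVec hq

theorem coef_star (l : List (Fin g)) (p : Poly g) : coef l (star p) = coef l.reverse p := by
  rw [← sum_coef_word (q := p) le_rfl, star_sum, map_sum, map_sum]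
  refine Finset.sum_congr rfl fun a _ => ?_
  simp only [star_smul_poly, star_word, map_smul, coef_word, List.reverse_eq_iff]

theorem degree_neg (p : Poly g) : degree (-p) = degree p :=
  eq_of_forall_ge_iff fun L => by simp only [degree_le_iff, map_neg, neg_eq_zero]

end Words

section Evaluation

variable {ι κ : Type*} [Fintype ι] [DecidableEq ι] [Fintype κ] [DecidableEq κ]

/-- Evaluation of free polynomials at tuples of matrices with an arbitrary finite index type, which
makes block matrices and Kronecker products available. -/
def evalOn (X : Fin g → Matrix ι ι ℝ) : Poly g →ₐ[ℝ] Matrix ι ι ℝ :=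
  FreeAlgebra.lift ℝ X

@[simp] theorem evalOn_ι (X : Fin g → Matrix ι ι ℝ) (j : Fin g) :
    evalOn X (FreeAlgebra.ι ℝ j) = X j := by
  simp [evalOn]

theorem sum_coef_smul_evalOn_word (X : Fin g → Matrix ι ι ℝ) {L : ℕ} {q : Poly g}
    (hq : degree q ≤ L) : ∑ a : Words g L, coef a.1 q • evalOn X (word a.1) = evalOn X q := by
  conv_rhs => rw [← sum_coef_word hq, map_sum]
  simp only [map_smul]

theorem evalOn_star {X : Fin g → Matrix ι ι ℝ} (hX : ∀ j, (X j).IsSymm) (p : Poly g) :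
    evalOn X (star p) = (evalOn X p)ᵀ := by
  induction p using FreeAlgebra.induction with
  | grade0 r => simp [FreeAlgebra.star_algebraMap, Matrix.algebraMap_eq_diagonal]
  | grade1 j => simp [(hX j).eq]
  | mul a b ha hb => simp [ha, hb]
  | add a b ha hb => simp [ha, hb]

theorem evalOn_isSymm {X : Fin g → Matrix ι ι ℝ} (hX : ∀ j, (X j).IsSymm) {p : Poly g}
    (hp : star p = p) : (evalOn X p).IsSymm := by
  rw [IsSymm, ← evalOn_star hX, hp]

theorem map_evalOn (φ : Matrix ι ι ℝ →ₐ[ℝ] Matrix κ κ ℝ) (X : Fin g → Matrix ι ι ℝ)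
    (p : Poly g) : φ (evalOn X p) = evalOn (fun j => φ (X j)) p := by
  have : φ.comp (evalOn X) = evalOn (fun j => φ (X j)) :=
    FreeAlgebra.hom_ext (funext fun j => by simp)
  exact DFunLike.congr_fun this p

theorem submatrix_evalOn (e : κ ≃ ι) (X : Fin g → Matrix ι ι ℝ) (p : Poly g) :
    (evalOn X p).submatrix e e = evalOn (fun j => (X j).submatrix e e) p :=
  map_evalOn (reindexAlgEquiv ℝ ℝ e.symm).toAlgHom X p

theorem evalOn_zero (p : Poly g) : evalOn (0 : Fin g → Matrix ι ι ℝ) p = coef [] p • 1 := by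
  rw [← sum_coef_smul_evalOn_word 0 le_rfl, Finset.sum_eq_single (Words.nil g (degree p))]
  · simp [Words.nil]
  · rintro ⟨_ | ⟨j, l⟩, hl⟩ - hne
    · exact absurd rfl hne
    · simp
  · simp

end Evaluation

section PositiveMatrices

variable {ι : Type*}

theorem dotProduct_self_nonneg [Fintype ι] (x : ι → ℝ) : 0 ≤ x ⬝ᵥ x :=
  dotProduct_self_star_nonneg x

open scoped MatrixOrder in
theorem exists_eq_transpose_mul_self [Fintype ι] {M : Matrix ι ι ℝ} (hM : M.PosSemidef) :
    ∃ S : Matrix ι ι ℝ, M = Sᵀ * S := by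
  classical
  obtain ⟨S, hS⟩ := CStarAlgebra.nonneg_iff_eq_star_mul_self.mp hM.nonneg
  exact ⟨S, by rwa [star_eq_conjTranspose, conjTranspose_eq_transpose_of_trivial] at hS⟩

theorem posDef_of_forall_mem_sphere [Fintype ι] {M : Matrix ι ι ℝ} (hM : M.IsSymm)
    (h : ∀ x ∈ Metric.sphere (0 : ι → ℝ) 1, 0 < x ⬝ᵥ M *ᵥ x) : M.PosDef := by
  refine PosDef.of_dotProduct_mulVec_pos (isHermitian_iff_isSymm.2 hM) fun x hx => ?_
  have hx0 : 0 < ‖x‖ := norm_pos_iff.2 hx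
  have hs := h (‖x‖⁻¹ • x) (by simp [norm_smul, hx0.ne'])
  rw [mulVec_smul, smul_dotProduct, dotProduct_smul, smul_eq_mul, smul_eq_mul] at hs
  rw [star_trivial]
  exact pos_of_mul_pos_right (pos_of_mul_pos_right hs (by positivity)) (by positivity)

theorem eventually_posDef [Finite ι] {T : Type*} [TopologicalSpace T]
    {G : T → Matrix ι ι ℝ} (hsymm : ∀ t, (G t).IsSymm) {t₀ : T} (hG : ContinuousAt G t₀)
    (h₀ : (G t₀).PosDef) :
    ∀ᶠ t in 𝓝 t₀, (G t).PosDef := by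
  have := Fintype.ofFinite ι
  have hpos : ∀ x ∈ Metric.sphere (0 : ι → ℝ) 1,
      ∀ᶠ z : T × (ι → ℝ) in 𝓝 (t₀, x), 0 < z.2 ⬝ᵥ G z.1 *ᵥ z.2 := fun x hx => by
    have hform : Continuous fun z : Matrix ι ι ℝ × (ι → ℝ) => z.2 ⬝ᵥ z.1 *ᵥ z.2 := by fun_prop
    have hcont : ContinuousAt (fun z : T × (ι → ℝ) => z.2 ⬝ᵥ G z.1 *ᵥ z.2) (t₀, x) :=
      hform.continuousAt.comp (f := fun z : T × (ι → ℝ) => (G z.1, z.2))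
        ((hG.comp continuousAt_fst).prodMk continuousAt_snd)
    exact hcont.eventually_const_lt
      (by simpa using h₀.dotProduct_mulVec_pos (ne_zero_of_mem_unit_sphere ⟨x, hx⟩))
  exact ((isCompact_sphere _ _).eventually_forall_of_forall_eventually hpos).mono fun t ht =>
    posDef_of_forall_mem_sphere (hsymm t) ht

/-- Finsler's lemma. -/
theorem eventually_posDef_add_smul [Fintype ι] {M Q : Matrix ι ι ℝ} (hM : M.IsSymm)
    (hQ : Q.PosSemidef)
    (h : ∀ x ≠ 0, x ⬝ᵥ Q *ᵥ x = 0 → 0 < x ⬝ᵥ M *ᵥ x) :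
    ∀ᶠ K : ℝ in atTop, (M + K • Q).PosDef := by
  have hform : ∀ (K : ℝ) (x : ι → ℝ),
      x ⬝ᵥ (M + K • Q) *ᵥ x = x ⬝ᵥ M *ᵥ x + K * (x ⬝ᵥ Q *ᵥ x) := fun K x => by
    rw [add_mulVec, smul_mulVec, dotProduct_add, dotProduct_smul, smul_eq_mul]
  have hQ0 : ∀ x : ι → ℝ, 0 ≤ x ⬝ᵥ Q *ᵥ x := fun x => by
    simpa using hQ.dotProduct_mulVec_nonneg x
  have hmono : Monotone fun K : ℝ => {x : ι → ℝ | 0 < x ⬝ᵥ (M + K • Q) *ᵥ x} :=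
    fun K K' hK x hx => by
      simp only [Set.mem_ofPred_eq, hform] at hx ⊢
      nlinarith [mul_le_mul_of_nonneg_right hK (hQ0 x)]
  obtain ⟨K₀, hK₀⟩ := (isCompact_sphere (0 : ι → ℝ) 1).elim_directed_cover
    (fun K : ℝ => {x : ι → ℝ | 0 < x ⬝ᵥ (M + K • Q) *ᵥ x})
    (fun K => isOpen_lt (by fun_prop) (by fun_prop))
    (fun x hx => by
      simp only [Set.mem_iUnion, Set.mem_ofPred_eq, hform]
      rcases (hQ0 x).eq_or_lt with h0 | hpos
      · exact ⟨0, by simpa using h x (ne_zero_of_mem_unit_sphere ⟨x, hx⟩) h0.symm⟩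
      · exact ((tendsto_atTop_add_const_left _ _
          (tendsto_id.atTop_mul_const hpos)).eventually_gt_atTop 0).exists)
    hmono.directed_le
  filter_upwards [eventually_ge_atTop K₀] with K hK
  refine posDef_of_forall_mem_sphere ?_ fun x hx => hmono hK (hK₀ hx)
  exact hM.add (IsSymm.smul (isHermitian_iff_isSymm.1 hQ.isHermitian) K)

theorem posSemidef_smul_one_sub_vecMulVec [Fintype ι] [DecidableEq ι] (v : ι → ℝ) :
    ((v ⬝ᵥ v) • 1 - vecMulVec v v : Matrix ι ι ℝ).PosSemidef := by
  refine PosSemidef.of_dotProduct_mulVec_nonneg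
    (isHermitian_iff_isSymm.2 (by simp [IsSymm, transpose_vecMulVec])) fun x => ?_
  have hcs := Finset.sum_mul_sq_le_sq_mul_sq Finset.univ v x
  simp only [sq] at hcs
  simp only [star_trivial, sub_mulVec, smul_mulVec, one_mulVec, vecMulVec_mulVec,
    dotProduct_sub, dotProduct_smul, op_smul_eq_smul, smul_eq_mul]
  rw [dotProduct_comm x v]
  exact sub_nonneg.2 hcs

/-- A symmetric matrix whose quadratic form takes the value `c` at `v ≠ 0` and which, for large `K`,
is as large as we please away from `v`. -/
def barrier [Fintype ι] [DecidableEq ι] (v : ι → ℝ) (c K : ℝ) : Matrix ι ι ℝ :=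
  (c / (v ⬝ᵥ v)) • 1 + K • ((v ⬝ᵥ v) • 1 - vecMulVec v v)

variable [Fintype ι] [DecidableEq ι]

theorem dotProduct_barrier_mulVec_self {v : ι → ℝ} (hv : v ≠ 0) (c K : ℝ) :
    v ⬝ᵥ barrier v c K *ᵥ v = c := by
  have hv' : v ⬝ᵥ v ≠ 0 := dotProduct_self_eq_zero.not.2 hv
  simp only [barrier, add_mulVec, smul_mulVec, sub_mulVec, one_mulVec, vecMulVec_mulVec,
    op_smul_eq_smul, sub_self, smul_zero, add_zero, dotProduct_smul, smul_eq_mul]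
  exact div_mul_cancel₀ c hv'

theorem eventually_posDef_barrier_sub {N : Matrix ι ι ℝ} (hN : N.IsSymm) {v : ι → ℝ} (hv : v ≠ 0)
    {c : ℝ} (h : v ⬝ᵥ N *ᵥ v < c) : ∀ᶠ K in atTop, (barrier v c K - N).PosDef := by
  have hQ := posSemidef_smul_one_sub_vecMulVec v
  have hv' : v ⬝ᵥ v ≠ 0 := dotProduct_self_eq_zero.not.2 hv
  have hM : ((c / (v ⬝ᵥ v)) • 1 - N).IsSymm := (isSymm_one.smul _).sub hN
  refine (eventually_posDef_add_smul hM hQ fun x hx hQx => ?_).mono fun K hK => ?_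
  · have hxv : (v ⬝ᵥ v) • x = (v ⬝ᵥ x) • v := by
      have hQx' := (hQ.dotProduct_mulVec_zero_iff x).1 (by simpa using hQx)
      simpa [sub_mulVec, smul_mulVec, vecMulVec_mulVec, sub_eq_zero] using hQx'
    obtain ⟨α, rfl⟩ : ∃ α : ℝ, x = α • v :=
      ⟨(v ⬝ᵥ v)⁻¹ * (v ⬝ᵥ x), by rw [mul_smul, ← hxv, inv_smul_smul₀ hv']⟩
    have hα : α ≠ 0 := by rintro rfl; simp at hx
    have hform : (α • v) ⬝ᵥ ((c / (v ⬝ᵥ v)) • 1 - N) *ᵥ (α • v) =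
        α ^ 2 * (c - v ⬝ᵥ N *ᵥ v) := by
      simp only [sub_mulVec, smul_mulVec, one_mulVec, mulVec_smul, dotProduct_sub,
        dotProduct_smul, smul_dotProduct, smul_eq_mul]
      field_simp
    rw [hform]
    exact mul_pos (by positivity) (sub_pos.2 h)
  · rwa [barrier, add_sub_right_comm]

end PositiveMatrices

section Midpoint

variable {ι : Type*} [Fintype ι] [DecidableEq ι] {p : Poly g} {X Y : Fin g → Matrix ι ι ℝ}

theorem IsQuasiConvex.posDef_sub_evalOn_midpoint (hp : IsQuasiConvex p)
    (hX : ∀ j, (X j).IsSymm) (hY : ∀ j, (Y j).IsSymm) {A : Matrix ι ι ℝ} (hA : A.PosDef)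
    (hAX : (A - evalOn X p).PosDef) (hAY : (A - evalOn Y p).PosDef) :
    (A - evalOn (midpoint ℝ X Y) p).PosDef := by
  let e := (Fintype.equivFin ι).symm
  have hmem : ∀ {Z : Fin g → Matrix ι ι ℝ}, (∀ j, (Z j).IsSymm) → (A - evalOn Z p).PosDef →
      (fun j => (Z j).submatrix e e) ∈ levelSet p (A.submatrix e e) := fun {Z} hZ hAZ => by
    refine ⟨fun j => (hZ j).submatrix e, ?_⟩
    rw [eval, ← evalOn, ← submatrix_evalOn]
    exact hAZ.submatrix e.injective
  have hmid : (midpoint ℝ (fun j => (X j).submatrix e e) fun j => (Y j).submatrix e e) =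
      fun j => (midpoint ℝ X Y j).submatrix e e := by
    simp only [midpoint_eq_smul_add]
    rfl
  have hposDef := ((hp.convex _ _ (hA.submatrix e.injective)).midpoint_mem
    (hmem hX hAX) (hmem hY hAY)).2
  rw [hmid, eval, ← evalOn, ← submatrix_evalOn] at hposDef
  simpa [submatrix_sub] using hposDef.submatrix e.symm.injective

theorem IsQuasiConvex.form_midpoint_lt (hp : IsQuasiConvex p)
    (hX : ∀ j, (X j).IsSymm) (hY : ∀ j, (Y j).IsSymm) {v : ι → ℝ} {c : ℝ} (hc : 0 < c)
    (h₁ : v ⬝ᵥ evalOn X p *ᵥ v < c) (h₂ : v ⬝ᵥ evalOn Y p *ᵥ v < c) :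
    v ⬝ᵥ evalOn (midpoint ℝ X Y) p *ᵥ v < c := by
  rcases eq_or_ne v 0 with rfl | hv
  · simpa using hc
  obtain ⟨K, hA, hAX, hAY⟩ := ((eventually_posDef_barrier_sub isSymm_zero hv (c := c)
    (by simpa using hc)).and ((eventually_posDef_barrier_sub (evalOn_isSymm hX hp.symmetric) hv
      h₁).and (eventually_posDef_barrier_sub (evalOn_isSymm hY hp.symmetric) hv h₂))).exists
  rw [sub_zero] at hA
  have hpos := (hp.posDef_sub_evalOn_midpoint hX hY hA hAX hAY).dotProduct_mulVec_pos hv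
  rwa [star_trivial, sub_mulVec, dotProduct_sub, dotProduct_barrier_mulVec_self hv,
    sub_pos] at hpos

end Midpoint

section SeparatingVector

variable {ι : Type*} [Fintype ι] [DecidableEq ι]

/-- A vector `v` is separating for the polynomials of degree at most `L` at the tuple `X` if no such
polynomial `q ≠ 0` satisfies `q(X)v = 0`. -/
def IsSeparating (X : Fin g → Matrix ι ι ℝ) (v : ι → ℝ) (L : ℕ) : Prop :=
  ∀ q : Poly g, degree q ≤ L → evalOn X q *ᵥ v = 0 → q = 0

theorem IsSeparating.exists_dotProduct_eq {X : Fin g → Matrix ι ι ℝ} {v : ι → ℝ} {L : ℕ}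
    (hv : IsSeparating X v L) (y : Words g L → ℝ) :
    ∃ b : ι → ℝ, ∀ a : Words g L, b ⬝ᵥ evalOn X (word a.1) *ᵥ v = y a := by
  let T : (Words g L → ℝ) →ₗ[ℝ] ι → ℝ :=
    (mulVecBilin ℝ ℝ).flip v ∘ₗ (evalOn X).toLinearMap ∘ₗ polyOf
  have hT : LinearMap.ker T = ⊥ := LinearMap.ker_eq_bot'.2 fun x hx => by
    rw [← coefVec_polyOf x, hv (polyOf x) (degree_polyOf_le x) hx, map_zero]
  obtain ⟨S, hS⟩ := T.exists_leftInverse_of_injective hT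
  obtain ⟨b, hb⟩ := (dotProductEquiv ℝ ι).surjective (dotProductEquiv ℝ (Words g L) y ∘ₗ S)
  refine ⟨b, fun a => ?_⟩
  have hTa : T (Pi.single a 1) = evalOn X (word a.1) *ᵥ v := by
    simp [T, polyOf]
  calc b ⬝ᵥ evalOn X (word a.1) *ᵥ v
      = (dotProductEquiv ℝ (Words g L) y ∘ₗ S) (T (Pi.single a 1)) := by rw [← hb, hTa]; rfl
    _ = dotProductEquiv ℝ (Words g L) y ((S ∘ₗ T) (Pi.single a 1)) := rfl
    _ = y a := by simp [hS]

/-- The compression of `l_j + l_j^*` to the words of length at most `L`, where `l_j` is the operator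
on the full Fock space which puts the letter `j` in front of a word. -/
def fock (g L : ℕ) : Fin g → Matrix (Words g L) (Words g L) ℝ :=
  fun j => of fun a b => if a.1 = j :: b.1 ∨ b.1 = j :: a.1 then 1 else 0

/-- The vacuum vector of the truncated Fock space. -/
def vacuum (g L : ℕ) : Words g L → ℝ := Pi.single (Words.nil g L) 1

theorem fock_isSymm (g L : ℕ) (j : Fin g) : (fock g L j).IsSymm := by
  ext a b
  simp [fock, or_comm]

theorem evalOn_fock_word_mulVec_vacuum_apply {L : ℕ} (c : List (Fin g)) (w : Words g L)
    (h : c.length ≤ w.1.length) :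
    (evalOn (fock g L) (word c) *ᵥ vacuum g L) w = if c = w.1 then 1 else 0 := by
  induction c generalizing w with
  | nil =>
    simp only [word_nil, map_one, one_mulVec, vacuum, Pi.single_apply, Words.nil, Subtype.ext_iff,
      eq_comm]
  | cons j c ih =>
    rw [List.length_cons] at h
    have hc : c.length ≤ L := by have := w.2; omega
    rw [word_cons, map_mul, evalOn_ι, ← mulVec_mulVec, mulVec, dotProduct,
      Finset.sum_eq_single (⟨c, hc⟩ : Words g L)]
    · have hne : c ≠ j :: w.1 := fun hcw => by simp [hcw] at h
      simp [ih ⟨c, hc⟩ le_rfl, fock, hne, eq_comm]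
    · intro b _ hb
      by_cases hwb : w.1 = j :: b.1 ∨ b.1 = j :: w.1
      · have hl : c.length ≤ b.1.length := by
          rcases hwb with h' | h' <;> have := congrArg List.length h' <;>
            simp only [List.length_cons] at this <;> omega
        rw [ih b hl, if_neg fun h' => hb (Subtype.ext h'.symm), mul_zero]
      · simp [fock, hwb]
    · simp

theorem isSeparating_fock (g L : ℕ) : IsSeparating (fock g L) (vacuum g L) L := by
  intro q hq h0
  by_contra hne
  obtain ⟨l, hl, hdeg⟩ := exists_coef_ne_zero_length_eq_degree hne
  -- At a longest word of `q` the Fock space vector `q(X)v` has that word's coefficient.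
  let w : Words g L := ⟨l, hdeg ▸ hq⟩
  have hcoord := congrFun h0 w
  rw [← sum_coef_smul_evalOn_word _ (le_refl (degree q)), sum_mulVec, Finset.sum_apply,
    Finset.sum_eq_single ⟨l, hdeg.le⟩] at hcoord
  · rw [smul_mulVec, Pi.smul_apply, evalOn_fock_word_mulVec_vacuum_apply l w le_rfl] at hcoord
    exact hl (by simpa [w] using hcoord)
  · intro a _ ha
    rw [smul_mulVec, Pi.smul_apply,
      evalOn_fock_word_mulVec_vacuum_apply a.1 w (a.2.trans hdeg.ge),
      if_neg fun h => ha (Subtype.ext h), smul_zero]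
  · simp

end SeparatingVector

section Bordered

variable {ι : Type*}

/-- The tuple `X` bordered by one row and column `t • b`. -/
def bordered (X : Fin g → Matrix ι ι ℝ) (b : Fin g → ι → ℝ) (t : ℝ) :
    Fin g → Matrix (ι ⊕ Unit) (ι ⊕ Unit) ℝ :=
  fun j => fromBlocks (X j) (t • replicateCol Unit (b j)) (t • replicateRow Unit (b j)) 0

theorem bordered_isSymm {X : Fin g → Matrix ι ι ℝ} (hX : ∀ j, (X j).IsSymm) (b : Fin g → ι → ℝ)
    (t : ℝ) (j : Fin g) : (bordered X b t j).IsSymm := by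
  simp [bordered, IsSymm, fromBlocks_transpose, (hX j).eq]

theorem midpoint_bordered_neg (X : Fin g → Matrix ι ι ℝ) (b : Fin g → ι → ℝ) (t : ℝ) :
    midpoint ℝ (bordered X b t) (bordered X b (-t)) = bordered X b 0 := by
  ext j (i | i) (k | k) <;> simp [bordered, midpoint_eq_smul_add, ← two_mul]

variable [Fintype ι]

theorem bordered_mulVec (X : Fin g → Matrix ι ι ℝ) (b : Fin g → ι → ℝ) (t : ℝ) (j : Fin g)
    (u : ι → ℝ) (s : ℝ) :
    bordered X b t j *ᵥ Sum.elim u (fun _ => s) =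
      Sum.elim (X j *ᵥ u + (t * s) • b j) (fun _ => t * (b j ⬝ᵥ u)) := by
  rw [bordered, fromBlocks_mulVec]
  congr 1 <;> funext i
  · simp [mulVec, dotProduct]
    ring
  · simp [mulVec, dotProduct, Finset.mul_sum, mul_assoc]

variable [DecidableEq ι]

/-- The coefficient of `t` in the border component of `l(Z_t)(v ⊕ 0)`, where `Z_t` is the tuple
`X` bordered by `t • b`. -/
def firstOrder (X : Fin g → Matrix ι ι ℝ) (b : Fin g → ι → ℝ) (v : ι → ℝ) : List (Fin g) → ℝ
  | [] => 0
  | j :: l => b j ⬝ᵥ evalOn X (word l) *ᵥ v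

/-- The coefficient of `t ^ 2` in the main component of `l(Z_t)(v ⊕ 0)`, where `Z_t` is the tuple
`X` bordered by `t • b`. -/
def secondOrder (X : Fin g → Matrix ι ι ℝ) (b : Fin g → ι → ℝ) (v : ι → ℝ) :
    List (Fin g) → ι → ℝ
  | [] => 0
  | j :: l => X j *ᵥ secondOrder X b v l + firstOrder X b v l • b j

theorem exists_evalOn_bordered_word_mulVec (X : Fin g → Matrix ι ι ℝ) (b : Fin g → ι → ℝ)
    (v : ι → ℝ) (l : List (Fin g)) :
    ∃ (S : ℝ → ι → ℝ) (z : ℝ → ℝ), Continuous S ∧ Continuous z ∧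
      S 0 = secondOrder X b v l ∧ z 0 = firstOrder X b v l ∧ ∀ t : ℝ,
        evalOn (bordered X b t) (word l) *ᵥ Sum.elim v (fun _ => 0) =
          Sum.elim (evalOn X (word l) *ᵥ v + t ^ 2 • S t) (fun _ => t * z t) := by
  induction l with
  | nil => exact ⟨0, 0, continuous_const, continuous_const, rfl, rfl, fun t => by simp⟩
  | cons j l ih =>
    obtain ⟨S, z, hS, hz, hS₀, hz₀, h⟩ := ih
    refine ⟨fun t => X j *ᵥ S t + z t • b j,
      fun t => b j ⬝ᵥ (evalOn X (word l) *ᵥ v + t ^ 2 • S t), by fun_prop, by fun_prop,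
      by simp [secondOrder, hS₀, hz₀], by simp [firstOrder], fun t => ?_⟩
    rw [word_cons, map_mul, evalOn_ι, ← mulVec_mulVec, h, bordered_mulVec]
    congr 1
    simp only [map_mul, evalOn_ι, mulVec_add, mulVec_smul, mulVec_mulVec]
    module

theorem exists_form_evalOn_bordered (X : Fin g → Matrix ι ι ℝ) (b : Fin g → ι → ℝ) (v : ι → ℝ)
    {p : Poly g} {L : ℕ} (hL : degree p ≤ L) :
    ∃ F : ℝ → ℝ, Continuous F ∧
      F 0 = ∑ a : Words g L, coef a.1 p * (v ⬝ᵥ secondOrder X b v a.1) ∧ ∀ t : ℝ,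
        Sum.elim v (fun _ => 0) ⬝ᵥ evalOn (bordered X b t) p *ᵥ Sum.elim v (fun _ => 0) =
          v ⬝ᵥ evalOn X p *ᵥ v + t ^ 2 * F t := by
  choose S z hS _ hS₀ _ h using exists_evalOn_bordered_word_mulVec X b v
  refine ⟨fun t => ∑ a : Words g L, coef a.1 p * (v ⬝ᵥ S a.1 t), ?_, ?_, fun t => ?_⟩
  · exact continuous_finsetSum _ fun a _ => by fun_prop
  · simp only [hS₀]
  · rw [← sum_coef_smul_evalOn_word _ hL, ← sum_coef_smul_evalOn_word X hL]
    simp only [sum_mulVec, smul_mulVec, h, dotProduct_sum, dotProduct_smul, smul_eq_mul,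
      sumElim_dotProduct_sumElim, dotProduct_add, Finset.mul_sum, ← Finset.sum_add_distrib]
    refine Finset.sum_congr rfl fun a _ => ?_
    simp
    ring

theorem IsQuasiConvex.sum_coef_mul_secondOrder_nonneg {p : Poly g} (hp : IsQuasiConvex p)
    {X : Fin g → Matrix ι ι ℝ} (hX : ∀ j, (X j).IsSymm) (b : Fin g → ι → ℝ) {v : ι → ℝ}
    (hv : 0 < v ⬝ᵥ evalOn X p *ᵥ v) {L : ℕ} (hL : degree p ≤ L) :
    0 ≤ ∑ a : Words g L, coef a.1 p * (v ⬝ᵥ secondOrder X b v a.1) := by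
  obtain ⟨F, hF, hF₀, hform⟩ := exists_form_evalOn_bordered X b v hL
  rw [← hF₀]
  by_contra! hneg
  have hsmall : ∀ᶠ t in 𝓝[≠] (0 : ℝ), t ≠ 0 ∧ F t < 0 ∧ F (-t) < 0 := by
    refine eventually_mem_nhdsWithin.and (nhdsWithin_le_nhds ?_)
    exact (hF.continuousAt.eventually_lt_const hneg).and
      ((hF.comp continuous_neg).continuousAt.eventually_lt_const (by simpa using hneg))
  obtain ⟨t, ht, hFt, hFt'⟩ := hsmall.exists
  have hlt : ∀ s : ℝ, s ≠ 0 → F s < 0 → Sum.elim v (fun _ => 0) ⬝ᵥ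
      evalOn (bordered X b s) p *ᵥ Sum.elim v (fun _ => 0) < v ⬝ᵥ evalOn X p *ᵥ v :=
    fun s hs hFs => by
      rw [hform]
      have := mul_neg_of_pos_of_neg (show 0 < s ^ 2 by positivity) hFs
      linarith
  have hmid := hp.form_midpoint_lt (bordered_isSymm hX b t) (bordered_isSymm hX b (-t)) hv
    (hlt t ht hFt) (hlt (-t) (neg_ne_zero.2 ht) hFt')
  rw [midpoint_bordered_neg, hform] at hmid
  simp at hmid

end Bordered

section MiddleMatrix

variable {ι : Type*} [Fintype ι] [DecidableEq ι]

/-- The middle matrix of the Hessian of `p`, indexed by the words of length at most `L`, with a zero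
row and a zero column at the empty word. -/
def middleMatrix (p : Poly g) (L : ℕ) : Matrix (Words g L) (Words g L) ℝ :=
  of fun u w => if u.1 = [] ∨ w.1 = [] then 0 else coef (u.1.reverse ++ w.1) p

theorem middleMatrix_isSymm {p : Poly g} (hp : star p = p) (L : ℕ) :
    (middleMatrix p L).IsSymm := by
  ext u w
  simp only [middleMatrix, transpose_apply, of_apply, or_comm (a := w.1 = [])]
  have hcoef := coef_star (u.1.reverse ++ w.1) p
  rw [hp, List.reverse_append, List.reverse_reverse] at hcoef
  rw [hcoef]

theorem dotProduct_evalOn_word_secondOrder {X : Fin g → Matrix ι ι ℝ} (hX : ∀ j, (X j).IsSymm)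
    (b : Fin g → ι → ℝ) (v : ι → ℝ) (l e : List (Fin g)) :
    (evalOn X (word e) *ᵥ v) ⬝ᵥ secondOrder X b v l = ∑ k ∈ Finset.range l.length,
      firstOrder X b v ((l.take (k + 1)).reverse ++ e) * firstOrder X b v (l.drop (k + 1)) := by
  induction l generalizing e with
  | nil => simp [secondOrder]
  | cons j l ih =>
    have hXj : (evalOn X (word e) *ᵥ v) ⬝ᵥ X j *ᵥ secondOrder X b v l =
        (evalOn X (word (j :: e)) *ᵥ v) ⬝ᵥ secondOrder X b v l := by
      rw [dotProduct_mulVec, ← mulVec_transpose, (hX j).eq, mulVec_mulVec, word_cons, map_mul,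
        evalOn_ι]
    rw [secondOrder, dotProduct_add, hXj, ih, List.length_cons, Finset.sum_range_succ']
    simp [firstOrder, dotProduct_comm, mul_comm]

theorem dotProduct_secondOrder {X : Fin g → Matrix ι ι ℝ} (hX : ∀ j, (X j).IsSymm)
    (b : Fin g → ι → ℝ) (v : ι → ℝ) (l : List (Fin g)) :
    v ⬝ᵥ secondOrder X b v l = ∑ k ∈ Finset.range (l.length + 1),
      firstOrder X b v (l.take k).reverse * firstOrder X b v (l.drop k) := by
  rw [Finset.sum_range_succ']
  simpa [firstOrder] using dotProduct_evalOn_word_secondOrder hX b v l []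

theorem sum_words_reverse_append_eq {L : ℕ} (f : List (Fin g) → List (Fin g) → ℝ)
    (l : Words g L) :
    ∑ u : Words g L, ∑ w : Words g L, (if u.1.reverse ++ w.1 = l.1 then f u.1 w.1 else 0) =
      ∑ k ∈ Finset.range (l.1.length + 1), f (l.1.take k).reverse (l.1.drop k) := by
  rw [← Finset.sum_product', ← Finset.sum_filter]
  refine Finset.sum_nbij' (fun uw => uw.1.1.length)
    (fun k => (⟨(l.1.take k).reverse, ?_⟩, ⟨l.1.drop k, ?_⟩)) ?_ ?_ ?_ ?_ ?_
  · have := l.2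
    simp
    omega
  · have := l.2
    simp
    omega
  · rintro ⟨u, w⟩ huw
    simp [← (Finset.mem_filter.1 huw).2]
  · simp
  · rintro ⟨u, w⟩ huw
    have hl := (Finset.mem_filter.1 huw).2
    simp [← hl]
  · intro k hk
    simpa [Nat.lt_succ_iff] using hk
  · rintro ⟨u, w⟩ huw
    simp [← (Finset.mem_filter.1 huw).2]

theorem sum_coef_mul_dotProduct_secondOrder {X : Fin g → Matrix ι ι ℝ} (hX : ∀ j, (X j).IsSymm)
    (b : Fin g → ι → ℝ) (v : ι → ℝ) {p : Poly g} {L : ℕ} (hL : degree p ≤ L) :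
    ∑ a : Words g L, coef a.1 p * (v ⬝ᵥ secondOrder X b v a.1) =
      (fun u => firstOrder X b v u.1) ⬝ᵥ middleMatrix p L *ᵥ fun w => firstOrder X b v w.1 := by
  set z := firstOrder X b v
  have hentry : ∀ u w : Words g L, z u.1 * (middleMatrix p L u w * z w.1) =
      ∑ a : Words g L, coef a.1 p * (if u.1.reverse ++ w.1 = a.1 then z u.1 * z w.1 else 0) := by
    intro u w
    have hcoef : coef (u.1.reverse ++ w.1) p =
        ∑ a : Words g L, coef a.1 p * (if u.1.reverse ++ w.1 = a.1 then 1 else 0) := by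
      conv_lhs => rw [← sum_coef_word hL]
      simp [coef_word]
    have hmid : z u.1 * (middleMatrix p L u w * z w.1) =
        coef (u.1.reverse ++ w.1) p * (z u.1 * z w.1) := by
      rw [middleMatrix, of_apply]
      split_ifs with h
      · rcases h with h | h <;> simp [h, z, firstOrder]
      · ring
    rw [hmid, hcoef, Finset.sum_mul]
    exact Finset.sum_congr rfl fun a _ => by split_ifs <;> ring
  calc ∑ a : Words g L, coef a.1 p * (v ⬝ᵥ secondOrder X b v a.1)
      = ∑ a : Words g L, ∑ u : Words g L, ∑ w : Words g L,
          coef a.1 p * (if u.1.reverse ++ w.1 = a.1 then z u.1 * z w.1 else 0) :=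
        Finset.sum_congr rfl fun a _ => by
          rw [dotProduct_secondOrder hX, ← sum_words_reverse_append_eq (fun u w => z u * z w) a]
          simp only [Finset.mul_sum]
    _ = ∑ u : Words g L, ∑ w : Words g L, ∑ a : Words g L,
          coef a.1 p * (if u.1.reverse ++ w.1 = a.1 then z u.1 * z w.1 else 0) := by
        rw [Finset.sum_comm]
        exact Finset.sum_congr rfl fun u _ => Finset.sum_comm
    _ = (fun u => z u.1) ⬝ᵥ middleMatrix p L *ᵥ fun w => z w.1 := by
        simp only [dotProduct, mulVec, Finset.mul_sum, hentry]

theorem IsSeparating.exists_firstOrder_eq {X : Fin g → Matrix ι ι ℝ} {v : ι → ℝ} {L : ℕ}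
    (hv : IsSeparating X v L) (x : Words g L → ℝ) :
    ∃ b : Fin g → ι → ℝ, ∀ u : Words g L, u.1 ≠ [] → firstOrder X b v u.1 = x u := by
  choose b hb using fun j : Fin g => hv.exists_dotProduct_eq fun a =>
    if h : (j :: a.1).length ≤ L then x ⟨j :: a.1, h⟩ else 0
  refine ⟨b, ?_⟩
  rintro ⟨_ | ⟨j, a⟩, hu⟩ hne
  · exact absurd rfl hne
  · exact (hb j ⟨a, (Nat.le_succ _).trans hu⟩).trans (dif_pos hu)

theorem IsQuasiConvex.middleMatrix_posSemidef {p : Poly g} (hp : IsQuasiConvex p)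
    {X : Fin g → Matrix ι ι ℝ} (hX : ∀ j, (X j).IsSymm) {v : ι → ℝ}
    (hpos : 0 < v ⬝ᵥ evalOn X p *ᵥ v) {L : ℕ} (hv : IsSeparating X v L) (hL : degree p ≤ L) :
    (middleMatrix p L).PosSemidef := by
  refine PosSemidef.of_dotProduct_mulVec_nonneg
    (isHermitian_iff_isSymm.2 (middleMatrix_isSymm hp.symmetric L)) fun x => ?_
  obtain ⟨b, hb⟩ := hv.exists_firstOrder_eq x
  have hform : x ⬝ᵥ middleMatrix p L *ᵥ x =
      (fun u => firstOrder X b v u.1) ⬝ᵥ middleMatrix p L *ᵥ fun w => firstOrder X b v w.1 := by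
    simp only [dotProduct, mulVec, Finset.mul_sum]
    refine Finset.sum_congr rfl fun u _ => Finset.sum_congr rfl fun w _ => ?_
    by_cases h : u.1 = [] ∨ w.1 = []
    · simp [middleMatrix, h]
    · rw [not_or] at h
      rw [hb u h.1, hb w h.2]
  rw [star_trivial, hform, ← sum_coef_mul_dotProduct_secondOrder hX b v hL]
  exact hp.sum_coef_mul_secondOrder_nonneg hX b hpos hL

theorem apply_eq_zero_of_posSemidef {κ : Type*} [Finite κ] {M : Matrix κ κ ℝ}
    (hM : M.PosSemidef) {j : κ} (hj : M j j = 0) (i : κ) : M i j = 0 := by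
  classical
  have := Fintype.ofFinite κ
  have hcol := (hM.dotProduct_mulVec_zero_iff (Pi.single j 1)).1 (by simpa using hj)
  simpa using congrFun hcol i

theorem degree_le_two_of_middleMatrix_posSemidef {p : Poly g} {L : ℕ} (hL : degree p ≤ L)
    (hM : (middleMatrix p L).PosSemidef) : degree p ≤ 2 := by
  by_contra! hd
  have hp : p ≠ 0 := by rintro rfl; simp [degree] at hd
  obtain ⟨l, hl, hdeg⟩ := exists_coef_ne_zero_length_eq_degree hp
  obtain ⟨j, i, a, rfl⟩ : ∃ j i a, l = j :: i :: a := by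
    match l, hdeg with
    | j :: i :: a, _ => exact ⟨j, i, a, rfl⟩
    | [_], h => simp at h; omega
    | [], h => simp at h; omega
  simp only [List.length_cons] at hdeg
  let u : Words g L := ⟨[j], by simp; omega⟩
  let w : Words g L := ⟨i :: a, by simp; omega⟩
  -- The diagonal entry at `w` is a coefficient of degree `2 * (degree p - 1) > degree p`.
  have hww : middleMatrix p L w w = 0 := by
    have hcoef : coef ((i :: a).reverse ++ i :: a) p = 0 :=
      coef_eq_zero_of_degree_lt (by simp; omega)
    simpa [middleMatrix, w] using hcoef
  exact hl (by simpa [middleMatrix, u, w] using apply_eq_zero_of_posSemidef hM hww u)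

theorem posSemidef_quadratic_of_middleMatrix_posSemidef {p : Poly g} {L : ℕ} (hL : 1 ≤ L)
    (hM : (middleMatrix p L).PosSemidef) :
    (of fun i j => coef [i, j] p : Matrix (Fin g) (Fin g) ℝ).PosSemidef := by
  convert hM.submatrix fun j : Fin g => (⟨[j], hL⟩ : Words g L)
  ext i j
  simp [middleMatrix]

theorem isLinear_sum_smul (c : Fin g → ℝ) : IsLinear (∑ j, c j • FreeAlgebra.ι ℝ j : Poly g) :=
  Submodule.sum_mem _ fun j _ => Submodule.smul_mem _ _ (Submodule.subset_span ⟨j, rfl⟩)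

theorem eq_linear_add_quadratic {p : Poly g} (hp : coef [] p = 0) (hd : degree p ≤ 2) :
    p = ∑ j, coef [j] p • word [j] + ∑ i, ∑ j, coef [i, j] p • word [i, j] := by
  refine poly_ext fun l => ?_
  simp only [map_add, map_sum, map_smul, coef_word, smul_eq_mul, mul_ite, mul_one, mul_zero]
  match l with
  | [] => simp [hp]
  | [k] => simp
  | [k, m] => simp [ite_and]
  | _ :: _ :: _ :: _ => simpa using coef_eq_zero_of_degree_lt (lt_of_le_of_lt hd (by simp))

theorem exists_eq_linear_add_squares {p : Poly g} (hp : coef [] p = 0) (hd : degree p ≤ 2)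
    (hQ : (of fun i j => coef [i, j] p : Matrix (Fin g) (Fin g) ℝ).PosSemidef) :
    ∃ (l : Poly g) (m : ℕ) (s : Fin m → Poly g),
      IsLinear l ∧ (∀ j, IsLinear (s j)) ∧ p = l + ∑ j, star (s j) * s j := by
  obtain ⟨S, hS⟩ := exists_eq_transpose_mul_self hQ
  have hcoef : ∀ i j, coef [i, j] p = ∑ k, S k i * S k j := fun i j => by
    simpa [mul_apply] using congrFun (congrFun hS i) j
  refine ⟨_, g, fun k => ∑ j, S k j • FreeAlgebra.ι ℝ j, isLinear_sum_smul fun j => coef [j] p,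
    fun k => isLinear_sum_smul _, (eq_linear_add_quadratic hp hd).trans ?_⟩
  simp only [word_cons, word_nil, mul_one, hcoef, star_sum, star_smul_poly, FreeAlgebra.star_ι,
    Finset.sum_mul_sum, smul_mul_smul_comm, Finset.sum_smul]
  congr 1
  conv_rhs => rw [Finset.sum_comm]
  exact Finset.sum_congr rfl fun i _ => Finset.sum_comm

theorem IsQuasiConvex.coef_nil {p : Poly g} (hp : IsQuasiConvex p) : coef [] p = 0 := by
  have h := congrFun (congrFun ((evalOn_zero p).symm.trans (hp.eval_zero 1)) 0) 0
  simpa using h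

end MiddleMatrix

section Gram

variable {L : ℕ}

/-- The polynomial with Gram matrix `G` with respect to the words of length at most `L`. -/
def gram : Matrix (Words g L) (Words g L) ℝ →ₗ[ℝ] Poly g where
  toFun G := ∑ a, ∑ b, G a b • (star (word a.1) * word b.1)
  map_add' G H := by simp [add_smul, Finset.sum_add_distrib]
  map_smul' c G := by simp [mul_smul, Finset.smul_sum]

theorem gram_apply (G : Matrix (Words g L) (Words g L) ℝ) :
    gram G = ∑ a, ∑ b, G a b • (star (word a.1) * word b.1) := rfl

theorem gram_vecMulVec (x : Words g L → ℝ) :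
    gram (vecMulVec x x) = star (polyOf x) * polyOf x := by
  simp only [gram_apply, polyOf_apply, star_sum, star_smul_poly, Finset.sum_mul_sum,
    smul_mul_smul_comm, vecMulVec_apply]

theorem gram_transpose_mul_self (S : Matrix (Words g L) (Words g L) ℝ) :
    gram (Sᵀ * S) = ∑ k, star (polyOf (S.row k)) * polyOf (S.row k) := by
  have hsum : Sᵀ * S = ∑ k, vecMulVec (S.row k) (S.row k) := by
    ext a b
    simp [mul_apply, Matrix.sum_apply, vecMulVec_apply]
  simp only [hsum, map_sum, gram_vecMulVec]

theorem degree_gram_le (G : Matrix (Words g L) (Words g L) ℝ) : degree (gram G) ≤ 2 * L :=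
  degree_le_iff.2 fun l hl => by
    simp only [gram_apply, map_sum, star_word, ← word_append, map_smul, coef_word]
    refine Finset.sum_eq_zero fun a _ => Finset.sum_eq_zero fun b _ => ?_
    rw [if_neg, smul_zero]
    rintro rfl
    have := a.2
    have := b.2
    rw [List.length_append, List.length_reverse] at hl
    omega

theorem isHermitianSOS_sum {κ : Type*} [Fintype κ] (h : κ → Poly g) :
    IsHermitianSOS (∑ k, star (h k) * h k) :=
  ⟨Fintype.card κ, fun i => h ((Fintype.equivFin κ).symm i),
    ((Fintype.equivFin κ).symm.sum_comp fun k => star (h k) * h k).symm⟩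

theorem isHermitianSOS_gram {G : Matrix (Words g L) (Words g L) ℝ} (hG : G.PosSemidef) :
    IsHermitianSOS (gram G) := by
  obtain ⟨S, rfl⟩ := exists_eq_transpose_mul_self hG
  rw [gram_transpose_mul_self]
  exact isHermitianSOS_sum _

theorem dotProduct_evalOn_star_mul_self {ι : Type*} [Fintype ι] [DecidableEq ι]
    {X : Fin g → Matrix ι ι ℝ} (hX : ∀ j, (X j).IsSymm) (v : ι → ℝ) (q : Poly g) :
    v ⬝ᵥ evalOn X (star q * q) *ᵥ v = (evalOn X q *ᵥ v) ⬝ᵥ (evalOn X q *ᵥ v) := by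
  rw [map_mul, evalOn_star hX, ← mulVec_mulVec, dotProduct_mulVec, vecMul_transpose]

theorem eq_zero_of_gram_eq_zero {G : Matrix (Words g L) (Words g L) ℝ} (hG : G.PosSemidef)
    (h : gram G = 0) : G = 0 := by
  obtain ⟨S, rfl⟩ := exists_eq_transpose_mul_self hG
  suffices hS : S = 0 by simp [hS]
  have hsum : ∑ k, (evalOn (fock g L) (polyOf (S.row k)) *ᵥ vacuum g L) ⬝ᵥ
      (evalOn (fock g L) (polyOf (S.row k)) *ᵥ vacuum g L) = 0 := by
    simp only [← dotProduct_evalOn_star_mul_self (fock_isSymm g L), ← dotProduct_sum, ← sum_mulVec,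
      ← map_sum, ← gram_transpose_mul_self, h, map_zero, zero_mulVec, dotProduct_zero]
  rw [Finset.sum_eq_zero_iff_of_nonneg fun _ _ => dotProduct_self_nonneg _] at hsum
  have hrow : ∀ k, S.row k = 0 := fun k => by
    rw [← coefVec_polyOf (S.row k), isSeparating_fock g L _ (degree_polyOf_le _)
      (dotProduct_self_eq_zero.1 (hsum k (Finset.mem_univ k))), map_zero]
  ext k a
  exact congrFun (hrow k) a

end Gram

section Density

variable (ι : Type*) [Fintype ι]

/-- The density matrices: the positive semidefinite matrices of trace one. -/
def density : Set (Matrix ι ι ℝ) := {G | G.PosSemidef ∧ G.trace = 1}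

theorem convex_density : Convex ℝ (density ι) := by
  intro G hG H hH a b ha hb hab
  refine ⟨(hG.1.smul ha).add (hH.1.smul hb), ?_⟩
  rw [trace_add, trace_smul, trace_smul, hG.2, hH.2]
  simpa using hab

variable {ι}

theorem zero_notMem_density : (0 : Matrix ι ι ℝ) ∉ density ι := fun h => by
  simpa using h.2

theorem inv_smul_vecMulVec_mem_density {x : ι → ℝ} (hx : x ≠ 0) :
    (x ⬝ᵥ x)⁻¹ • vecMulVec x x ∈ density ι := by
  refine ⟨PosSemidef.smul (by simpa using posSemidef_vecMulVec_self_star x)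
    (inv_nonneg.2 (dotProduct_self_nonneg x)), ?_⟩
  rw [trace_smul, trace_vecMulVec, smul_eq_mul, inv_mul_cancel₀ (dotProduct_self_eq_zero.not.2 hx)]

theorem abs_apply_le_trace {G : Matrix ι ι ℝ} (hG : G.PosSemidef) (i j : ι) :
    |G i j| ≤ G.trace := by
  classical
  have hdiag : ∀ k, G k k ≤ G.trace := fun k =>
    Finset.single_le_sum (f := fun k => G k k) (fun k _ => hG.diag_nonneg) (Finset.mem_univ k)
  have hsymm : G j i = G i j := (isHermitian_iff_isSymm.1 hG.isHermitian).apply i j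
  have hadd := hG.dotProduct_mulVec_nonneg (Pi.single i 1 + Pi.single j 1)
  have hsub := hG.dotProduct_mulVec_nonneg (Pi.single i 1 - Pi.single j 1)
  simp only [star_trivial, mulVec_add, mulVec_sub, add_dotProduct, sub_dotProduct, dotProduct_add,
    dotProduct_sub, mulVec_single_one, single_one_dotProduct, col_apply, hsymm] at hadd hsub
  exact abs_le.2 ⟨by linarith [hdiag i, hdiag j], by linarith [hdiag i, hdiag j]⟩

omit [Fintype ι] in
theorem isClosed_setOf_posSemidef [Finite ι] : IsClosed {G : Matrix ι ι ℝ | G.PosSemidef} := by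
  have := Fintype.ofFinite ι
  simp only [posSemidef_iff_dotProduct_mulVec, isHermitian_iff_isSymm, IsSymm, star_trivial,
    Set.ofPred_and, Set.ofPred_forall]
  exact (isClosed_eq (by fun_prop) continuous_id).inter
    (isClosed_iInter fun x => isClosed_le continuous_const (by fun_prop))

theorem isCompact_density : IsCompact (density ι) := by
  have hbox : IsCompact (Set.univ.pi fun _ : ι => Set.univ.pi fun _ : ι => Set.Icc (-1 : ℝ) 1) :=
    isCompact_univ_pi fun _ => isCompact_univ_pi fun _ => isCompact_Icc
  refine hbox.of_isClosed_subset (isClosed_setOf_posSemidef.inter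
    (isClosed_eq (Continuous.matrix_trace continuous_id) continuous_const)) ?_
  intro G hG i _ j _
  rw [Set.mem_Icc, ← abs_le, ← hG.2]
  exact abs_apply_le_trace hG.1 i j

end Density

section Separation

theorem isCompact_convexJoin_singleton {E : Type*} [AddCommGroup E] [Module ℝ E]
    [TopologicalSpace E] [IsTopologicalAddGroup E] [ContinuousSMul ℝ E] {K : Set E}
    (hK : IsCompact K) (x : E) : IsCompact (convexJoin ℝ K {x}) := by
  have himage : convexJoin ℝ K {x} =
      (fun z : E × ℝ => AffineMap.lineMap z.1 x z.2) '' K ×ˢ Set.Icc 0 1 := by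
    ext y
    simp [segment_eq_image_lineMap, and_assoc]
  rw [himage]
  refine (hK.prod isCompact_Icc).image ?_
  simp only [AffineMap.lineMap_apply_module]
  fun_prop

theorem exists_strongDual_neg_of_forall_smul_notMem {E : Type*} [AddCommGroup E] [Module ℝ E]
    [TopologicalSpace E] [IsTopologicalAddGroup E] [ContinuousSMul ℝ E] [LocallyConvexSpace ℝ E]
    [T2Space E] {K : Set E} (hconv : Convex ℝ K) (hK : IsCompact K) {x : E} (hx : x ≠ 0)
    (h : ∀ s : ℝ, 0 ≤ s → s • x ∉ K) :
    ∃ φ : StrongDual ℝ E, φ x < 0 ∧ ∀ y ∈ K, 0 < φ y := by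
  rcases K.eq_empty_or_nonempty with rfl | hne
  · obtain ⟨φ, hφ⟩ := geometric_hahn_banach_point_point hx
    exact ⟨φ, by simpa using hφ, by simp⟩
  -- Hahn-Banach separates the origin from the convex hull of `K` and `-x`.
  have h0 : (0 : E) ∉ convexJoin ℝ K {-x} := by
    simp only [mem_convexJoin, Set.mem_singleton_iff, exists_eq_left, not_exists, not_and]
    rintro y hy ⟨a, b, ha, hb, hab, h0⟩
    rw [smul_neg, ← sub_eq_add_neg, sub_eq_zero] at h0
    rcases ha.eq_or_lt with rfl | ha
    · rw [zero_add] at hab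
      exact hx (by simpa [hab] using h0.symm)
    · refine h (a⁻¹ * b) (by positivity) ?_
      rwa [mul_smul, ← h0, inv_smul_smul₀ ha.ne']
  obtain ⟨φ, u, hu, hφ⟩ := geometric_hahn_banach_point_closed
    (hconv.convexJoin (convex_singleton (-x)))
    (isCompact_convexJoin_singleton hK (-x)).isClosed h0
  rw [map_zero] at hu
  refine ⟨φ, ?_, fun y hy => ?_⟩
  · have hneg := hu.trans (hφ _ (subset_convexJoin_right hne rfl))
    rwa [map_neg, neg_pos] at hneg
  · exact hu.trans (hφ y (subset_convexJoin_left (Set.singleton_nonempty _) hy))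

end Separation

section Functionals

theorem exists_functional_neg_of_not_isHermitianSOS {f : Poly g} (hf : ¬ IsHermitianSOS f)
    {L : ℕ} (hL : degree f ≤ 2 * L) :
    ∃ Λ : Poly g →ₗ[ℝ] ℝ, Λ f < 0 ∧ ∀ q ≠ 0, degree q ≤ L → 0 < Λ (star q * q) := by
  set T : Matrix (Words g L) (Words g L) ℝ →ₗ[ℝ] (Words g (2 * L) → ℝ) :=
    coefVec (2 * L) ∘ₗ gram with hT
  have hpolyOf : ∀ G, polyOf (T G) = gram G := fun G => polyOf_coefVec (degree_gram_le G)
  have hne : coefVec (2 * L) f ≠ 0 := fun h0 => hf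
    ⟨0, Fin.elim0, by rw [← polyOf_coefVec hL, h0, map_zero, Finset.univ_eq_empty,
      Finset.sum_empty]⟩
  have hcone : ∀ s : ℝ, 0 ≤ s → s • coefVec (2 * L) f ∉ T '' density (Words g L) := by
    rintro s hs ⟨G, hG, hGs⟩
    have heq : gram G = s • f := by
      rw [← hpolyOf, hGs, map_smul, polyOf_coefVec hL]
    rcases hs.eq_or_lt with rfl | hs
    · rw [zero_smul] at heq
      exact zero_notMem_density (eq_zero_of_gram_eq_zero hG.1 heq ▸ hG)
    · have hsos := isHermitianSOS_gram (hG.1.smul (inv_nonneg.2 hs.le))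
      rw [map_smul, heq, inv_smul_smul₀ hs.ne'] at hsos
      exact hf hsos
  obtain ⟨φ, hφf, hφ⟩ := exists_strongDual_neg_of_forall_smul_notMem
    ((convex_density _).linear_image T)
    (isCompact_density.image T.continuous_of_finiteDimensional) hne hcone
  refine ⟨φ.toLinearMap ∘ₗ coefVec (2 * L), hφf, fun q hq hqL => ?_⟩
  have hx : coefVec L q ≠ 0 := fun h => hq (by rw [← polyOf_coefVec hqL, h, map_zero])
  have hpos := hφ _ ⟨_, inv_smul_vecMulVec_mem_density hx, rfl⟩
  rw [map_smul, map_smul, smul_eq_mul, hT, LinearMap.comp_apply, gram_vecMulVec,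
    polyOf_coefVec hqL] at hpos
  exact pos_of_mul_pos_right hpos (inv_nonneg.2 (dotProduct_self_nonneg _))

theorem exists_star_invariant_functional {f : Poly g} (hf : star f = f)
    (hsos : ¬ IsHermitianSOS f) {L : ℕ} (hL : degree f ≤ 2 * L) :
    ∃ Λ : Poly g →ₗ[ℝ] ℝ, (∀ q, Λ (star q) = Λ q) ∧ Λ f < 0 ∧
      ∀ q ≠ 0, degree q ≤ L → 0 < Λ (star q * q) := by
  obtain ⟨Λ, hΛf, hΛ⟩ := exists_functional_neg_of_not_isHermitianSOS hsos hL
  let starLin : Poly g →ₗ[ℝ] Poly g :=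
    { toFun := star, map_add' := star_add, map_smul' := star_smul_poly }
  have happly : ∀ q, (Λ + Λ ∘ₗ starLin) q = Λ q + Λ (star q) := fun q => rfl
  refine ⟨Λ + Λ ∘ₗ starLin, fun q => ?_, ?_, fun q hq hqL => ?_⟩
  · rw [happly, happly, star_star, add_comm]
  · rw [happly, hf]
    exact add_neg hΛf hΛf
  · rw [happly, star_mul, star_star]
    exact add_pos (hΛ q hq hqL) (hΛ q hq hqL)

/-- The matrix of the form `(q, q') ↦ Λ (q^* r q')` with respect to the words of length at
most `L`. For `r = 1` it is the moment (Hankel) matrix of `Λ`, for `r = x_j` it represents the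
multiplication by `x_j`. -/
def momentMatrix (Λ : Poly g →ₗ[ℝ] ℝ) (L : ℕ) (r : Poly g) :
    Matrix (Words g L) (Words g L) ℝ :=
  of fun a b => Λ (star (word a.1) * (r * word b.1))

variable {Λ : Poly g →ₗ[ℝ] ℝ} {L : ℕ}

theorem momentMatrix_isSymm (hΛ : ∀ q, Λ (star q) = Λ q) {r : Poly g} (hr : star r = r) :
    (momentMatrix Λ L r).IsSymm := by
  ext a b
  rw [momentMatrix, transpose_apply, of_apply, of_apply, ← hΛ, star_mul, star_mul, star_star, hr,
    mul_assoc]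

theorem dotProduct_momentMatrix_one_mulVec_self (x : Words g L → ℝ) :
    x ⬝ᵥ momentMatrix Λ L 1 *ᵥ x = Λ (star (polyOf x) * polyOf x) := by
  simp only [← gram_vecMulVec, gram_apply, map_sum, map_smul, smul_eq_mul, vecMulVec_apply,
    dotProduct, mulVec, Finset.mul_sum, momentMatrix, of_apply, one_mul]
  exact Finset.sum_congr rfl fun a _ => Finset.sum_congr rfl fun b _ => by ring

theorem momentMatrix_one_posDef (hΛ : ∀ q, Λ (star q) = Λ q)
    (hpos : ∀ q ≠ 0, degree q ≤ L → 0 < Λ (star q * q)) : (momentMatrix Λ L 1).PosDef := by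
  refine PosDef.of_dotProduct_mulVec_pos
    (isHermitian_iff_isSymm.2 (momentMatrix_isSymm hΛ (star_one _))) fun x hx => ?_
  rw [star_trivial, dotProduct_momentMatrix_one_mulVec_self]
  refine hpos _ (fun h => hx ?_) (degree_polyOf_le x)
  rw [← coefVec_polyOf x, h, map_zero]

theorem momentMatrix_ι_mulVec_single {j : Fin g} {l : List (Fin g)} (hl : (j :: l).length ≤ L) :
    momentMatrix Λ L (FreeAlgebra.ι ℝ j) *ᵥ
        Pi.single ⟨l, (Nat.le_succ _).trans hl⟩ 1 =
      momentMatrix Λ L 1 *ᵥ Pi.single ⟨j :: l, hl⟩ 1 := by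
  ext a
  simp [momentMatrix]

-- The Gelfand-Naimark-Segal construction, compressed to the words of length at most `L`.
theorem exists_evalOn_mulVec_eq_mulVec_coefVec (hΛ : ∀ q, Λ (star q) = Λ q)
    (hpos : ∀ q ≠ 0, degree q ≤ L → 0 < Λ (star q * q)) :
    ∃ (X : Fin g → Matrix (Words g L) (Words g L) ℝ) (S : Matrix (Words g L) (Words g L) ℝ),
      (∀ j, (X j).IsSymm) ∧ IsUnit S.det ∧ Sᵀ * S = momentMatrix Λ L 1 ∧
      ∀ q, degree q ≤ L → evalOn X q *ᵥ S *ᵥ vacuum g L = S *ᵥ coefVec L q := by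
  have hM := momentMatrix_one_posDef hΛ hpos
  obtain ⟨S, hS⟩ := exists_eq_transpose_mul_self hM.posSemidef
  have hdet : IsUnit S.det := by
    have hunit := (isUnit_iff_isUnit_det _).1 hM.isUnit
    rw [hS, det_mul] at hunit
    exact isUnit_of_mul_isUnit_right hunit
  let X : Fin g → Matrix (Words g L) (Words g L) ℝ := fun j =>
    S⁻¹ᵀ * momentMatrix Λ L (FreeAlgebra.ι ℝ j) * S⁻¹
  have hword : ∀ (l : List (Fin g)) (hl : l.length ≤ L),
      evalOn X (word l) *ᵥ S *ᵥ vacuum g L = S *ᵥ Pi.single ⟨l, hl⟩ 1 := fun l => by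
    induction l with
    | nil => intro hl; simp [vacuum, Words.nil]
    | cons j l ih =>
      intro hl
      calc evalOn X (word (j :: l)) *ᵥ S *ᵥ vacuum g L
          = X j *ᵥ S *ᵥ Pi.single ⟨l, (Nat.le_succ _).trans hl⟩ 1 := by
            rw [word_cons, map_mul, evalOn_ι, ← mulVec_mulVec, ih]
        _ = S⁻¹ᵀ *ᵥ (momentMatrix Λ L (FreeAlgebra.ι ℝ j) *ᵥ
              Pi.single ⟨l, (Nat.le_succ _).trans hl⟩ 1) := by
            simp only [X, mulVec_mulVec, Matrix.mul_assoc, nonsing_inv_mul _ hdet, Matrix.mul_one]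
        _ = S *ᵥ Pi.single ⟨j :: l, hl⟩ 1 := by
            rw [momentMatrix_ι_mulVec_single hl, hS, mulVec_mulVec, ← Matrix.mul_assoc,
              ← transpose_mul, mul_nonsing_inv _ hdet, transpose_one, Matrix.one_mul]
  refine ⟨X, S, fun j => ?_, hdet, hS.symm, fun q hq => ?_⟩
  · simp only [X, IsSymm, transpose_mul, transpose_transpose, Matrix.mul_assoc,
      (momentMatrix_isSymm hΛ (FreeAlgebra.star_ι j)).eq]
  · rw [← sum_coef_smul_evalOn_word X hq, sum_mulVec, pi_eq_sum_univ' (coefVec L q), mulVec_sum]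
    simp only [smul_mulVec, mulVec_smul, coefVec_apply, fun a : Words g L => hword a.1 a.2]

theorem exists_isSeparating_form_eq (hΛ : ∀ q, Λ (star q) = Λ q)
    (hpos : ∀ q ≠ 0, degree q ≤ L → 0 < Λ (star q * q)) :
    ∃ (X : Fin g → Matrix (Words g L) (Words g L) ℝ) (v : Words g L → ℝ),
      (∀ j, (X j).IsSymm) ∧ IsSeparating X v L ∧
      ∀ q, degree q ≤ L → v ⬝ᵥ evalOn X q *ᵥ v = Λ q := by
  obtain ⟨X, S, hX, hdet, hS, hq⟩ := exists_evalOn_mulVec_eq_mulVec_coefVec hΛ hpos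
  refine ⟨X, S *ᵥ vacuum g L, hX, fun q hqL h0 => ?_, fun q hqL => ?_⟩
  · rw [hq q hqL] at h0
    rw [← polyOf_coefVec hqL, eq_zero_of_mulVec_eq_zero hdet.ne_zero h0, map_zero]
  · calc (S *ᵥ vacuum g L) ⬝ᵥ evalOn X q *ᵥ S *ᵥ vacuum g L
        = vacuum g L ⬝ᵥ momentMatrix Λ L 1 *ᵥ coefVec L q := by
          rw [hq q hqL, ← hS, ← mulVec_mulVec, dotProduct_mulVec _ Sᵀ, vecMul_transpose]
      _ = ∑ a : Words g L, Λ (word a.1) * coef a.1 q := by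
          rw [vacuum, single_one_dotProduct]
          simp [mulVec, dotProduct, momentMatrix, Words.nil, coefVec_apply]
      _ = Λ q := by
          conv_rhs => rw [← sum_coef_word hqL, map_sum]
          simp only [map_smul, smul_eq_mul, mul_comm]

theorem exists_isSeparating_form_neg {f : Poly g} (hf : star f = f) (hsos : ¬ IsHermitianSOS f)
    (hL : degree f ≤ L) :
    ∃ (X : Fin g → Matrix (Words g L) (Words g L) ℝ) (v : Words g L → ℝ),
      (∀ j, (X j).IsSymm) ∧ IsSeparating X v L ∧ v ⬝ᵥ evalOn X f *ᵥ v < 0 := by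
  obtain ⟨Λ, hΛ, hΛf, hpos⟩ := exists_star_invariant_functional hf hsos
    (hL.trans (Nat.le_mul_of_pos_left L two_pos))
  obtain ⟨X, v, hX, hv, hform⟩ := exists_isSeparating_form_eq hΛ hpos
  exact ⟨X, v, hX, hv, (hform f hL).trans_lt hΛf⟩

theorem IsQuasiConvex.isHermitianSOS_neg_or_eq_linear_add_squares {p : Poly g}
    (hp : IsQuasiConvex p) :
    IsHermitianSOS (-p) ∨ (degree p ≤ 2 ∧ ∃ (l : Poly g) (m : ℕ) (s : Fin m → Poly g),
      IsLinear l ∧ (∀ j, IsLinear (s j)) ∧ p = l + ∑ j, star (s j) * s j) := by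
  refine or_iff_not_imp_left.2 fun hsos => ?_
  obtain ⟨X, v, hX, hv, hneg⟩ := exists_isSeparating_form_neg (L := degree p + 1)
    (by rw [star_neg, hp.symmetric]) hsos ((degree_neg p).trans_le (Nat.le_succ _))
  rw [map_neg, neg_mulVec, dotProduct_neg, neg_lt_zero] at hneg
  have hM := hp.middleMatrix_posSemidef hX hneg hv (Nat.le_succ _)
  have hd := degree_le_two_of_middleMatrix_posSemidef (Nat.le_succ _) hM
  exact ⟨hd, exists_eq_linear_add_squares hp.coef_nil hd
    (posSemidef_quadratic_of_middleMatrix_posSemidef (Nat.le_add_left _ _) hM)⟩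

end Functionals

section PauliFamily

open scoped Kronecker

theorem map₂_kroneckerBilinear_top (ι κ : Type*) [Finite ι] [Finite κ] :
    Submodule.map₂ (kroneckerBilinear (R := ℝ) (α := ℝ) :
      Matrix ι ι ℝ →ₗ[ℝ] Matrix κ κ ℝ →ₗ[ℝ] Matrix (ι × κ) (ι × κ) ℝ) ⊤ ⊤ = ⊤ := by
  classical
  have := Fintype.ofFinite ι
  have := Fintype.ofFinite κ
  refine eq_top_iff.2 fun M _ => ?_
  rw [matrix_eq_sum_single M]
  refine Submodule.sum_mem _ fun i _ => Submodule.sum_mem _ fun j _ => ?_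
  have hsingle : single i j (M i j) = single i.1 j.1 (M i j) ⊗ₖ single i.2 j.2 (1 : ℝ) := by
    rw [single_kronecker_single, mul_one]
  rw [hsingle]
  exact Submodule.apply_mem_map₂ _ Submodule.mem_top Submodule.mem_top

/-- A family of invertible matrices which spans the full matrix algebra and whose members are, up
to scalars, symmetric and pairwise commuting. The standard examples are the tensor products of real
Pauli matrices. -/
structure IsPauliFamily {ι J : Type*} [Fintype ι] [DecidableEq ι] (P : J → Matrix ι ι ℝ) :
    Prop where
  isUnit : ∀ a, IsUnit (P a)
  transpose_eq_smul : ∀ a, ∃ s : ℝ, (P a)ᵀ = s • P a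
  mul_eq_smul_mul : ∀ a b, ∃ s : ℝ, P a * P b = s • (P b * P a)
  span_eq_top : Submodule.span ℝ (Set.range P) = ⊤

variable {ι κ J K : Type*} [Fintype ι] [DecidableEq ι] [Fintype κ] [DecidableEq κ]

theorem IsPauliFamily.kronecker {P : J → Matrix ι ι ℝ} {Q : K → Matrix κ κ ℝ}
    (hP : IsPauliFamily P) (hQ : IsPauliFamily Q) :
    IsPauliFamily fun a : J × K => P a.1 ⊗ₖ Q a.2 where
  isUnit a := (hP.isUnit a.1).kronecker (hQ.isUnit a.2)
  transpose_eq_smul a := by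
    obtain ⟨s, hs⟩ := hP.transpose_eq_smul a.1
    obtain ⟨t, ht⟩ := hQ.transpose_eq_smul a.2
    exact ⟨s * t, by
      rw [← kroneckerMap_transpose, hs, ht, smul_kronecker, kronecker_smul, smul_smul]⟩
  mul_eq_smul_mul a b := by
    obtain ⟨s, hs⟩ := hP.mul_eq_smul_mul a.1 b.1
    obtain ⟨t, ht⟩ := hQ.mul_eq_smul_mul a.2 b.2
    exact ⟨s * t, by rw [← mul_kronecker_mul, ← mul_kronecker_mul, hs, ht, smul_kronecker,
      kronecker_smul, smul_smul]⟩
  span_eq_top := by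
    have hspan := Submodule.map₂_span_span ℝ (kroneckerBilinear (R := ℝ) (α := ℝ) :
      Matrix ι ι ℝ →ₗ[ℝ] Matrix κ κ ℝ →ₗ[ℝ] _) (Set.range P) (Set.range Q)
    rw [hP.span_eq_top, hQ.span_eq_top, Set.image2_range, map₂_kroneckerBilinear_top] at hspan
    exact hspan.symm

/-- The real Pauli matrices. -/
def pauli : Fin 4 → Matrix (Fin 2) (Fin 2) ℝ :=
  ![1, !![1, 0; 0, -1], !![0, 1; 1, 0], !![0, 1; -1, 0]]

theorem isPauliFamily_pauli : IsPauliFamily pauli where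
  isUnit a := by
    rw [isUnit_iff_isUnit_det]
    fin_cases a <;> simp [pauli, det_fin_two]
  transpose_eq_smul a :=
    ⟨![1, 1, 1, -1] a, by fin_cases a <;> simp [pauli, ← Matrix.ext_iff]⟩
  mul_eq_smul_mul a b := by
    have : pauli a * pauli b = pauli b * pauli a ∨ pauli a * pauli b = -(pauli b * pauli a) := by
      fin_cases a <;> fin_cases b <;> simp [pauli, ← Matrix.ext_iff]
    rcases this with h | h
    · exact ⟨1, by rw [h, one_smul]⟩
    · exact ⟨-1, by rw [h, neg_one_smul]⟩
  span_eq_top := by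
    refine eq_top_iff.2 fun M _ => (Submodule.mem_span_range_iff_exists_fun ℝ).2
      ⟨![(M 0 0 + M 1 1) / 2, (M 0 0 - M 1 1) / 2, (M 0 1 + M 1 0) / 2, (M 0 1 - M 1 0) / 2], ?_⟩
    ext i j
    fin_cases i <;> fin_cases j <;> simp [pauli, Fin.sum_univ_four] <;> ring

theorem exists_isPauliFamily_card_eq (k : ℕ) :
    ∃ (ι J : Type) (_ : Fintype ι) (_ : DecidableEq ι) (_ : Fintype J) (P : J → Matrix ι ι ℝ),
      IsPauliFamily P ∧ Fintype.card ι = 2 ^ (k + 1) := by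
  induction k with
  | zero =>
    exact ⟨Fin 2, Fin 4, inferInstance, inferInstance, inferInstance, pauli, isPauliFamily_pauli,
      rfl⟩
  | succ k ih =>
    obtain ⟨ι, J, _, _, _, P, hP, hcard⟩ := ih
    exact ⟨ι × Fin 2, J × Fin 4, inferInstance, inferInstance, inferInstance, _,
      hP.kronecker isPauliFamily_pauli, by
        rw [Fintype.card_prod, hcard, Fintype.card_fin, ← pow_succ]⟩

variable {P : J → Matrix ι ι ℝ}

theorem IsPauliFamily.exists_sum_smul_eq [Fintype J] (hP : IsPauliFamily P) {M : Matrix ι ι ℝ}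
    (hM : M.IsSymm) : ∃ c : J → ℝ, (∀ a, (c a • P a).IsSymm) ∧ ∑ a, c a • P a = M := by
  obtain ⟨c, hc⟩ := (Submodule.mem_span_range_iff_exists_fun ℝ).1
    (hP.span_eq_top ▸ Submodule.mem_top : M ∈ Submodule.span ℝ (Set.range P))
  choose s hs using hP.transpose_eq_smul
  have hsymm : ∀ a, (c a * (1 + s a) / 2) • P a = (c a / 2) • (P a + (P a)ᵀ) := fun a => by
    rw [hs, smul_add, smul_smul, ← add_smul]
    ring_nf
  refine ⟨fun a => c a * (1 + s a) / 2, fun a => ?_, ?_⟩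
  · rw [hsymm]
    exact (isSymm_add_transpose_self _).smul _
  · have hMt : ∑ a, c a • (P a)ᵀ = M := by
      rw [← hM.eq, ← hc, transpose_sum]
      simp only [transpose_smul]
    simp only [hsymm]
    simp only [div_eq_inv_mul, mul_smul, smul_add, Finset.sum_add_distrib]
    rw [← Finset.smul_sum, ← Finset.smul_sum, hc, hMt, ← add_smul]
    norm_num

theorem IsPauliFamily.exists_prod_eq_smul_of_perm (hP : IsPauliFamily P) {l m : List J}
    (h : l.Perm m) : ∃ s : ℝ, (l.map P).prod = s • (m.map P).prod := by
  induction h with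
  | nil => exact ⟨1, by simp⟩
  | cons a _ ih =>
    obtain ⟨s, hs⟩ := ih
    exact ⟨s, by simp [hs]⟩
  | swap a b l =>
    obtain ⟨s, hs⟩ := hP.mul_eq_smul_mul b a
    exact ⟨s, by simp [← mul_assoc, hs]⟩
  | trans _ _ ih₁ ih₂ =>
    obtain ⟨s, hs⟩ := ih₁
    obtain ⟨t, ht⟩ := ih₂
    exact ⟨s * t, by rw [hs, ht, smul_smul]⟩

/-- The product of a multiset of members of a family, in an arbitrarily chosen order. -/
def multisetProd (P : J → Matrix ι ι ℝ) (γ : Multiset J) : Matrix ι ι ℝ :=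
  (γ.toList.map P).prod

theorem IsPauliFamily.isUnit_multisetProd (hP : IsPauliFamily P) (γ : Multiset J) :
    IsUnit (multisetProd P γ) :=
  Submonoid.list_prod_mem (IsUnit.submonoid _) (List.forall_mem_map.2 fun a _ => hP.isUnit a)

theorem IsPauliFamily.exists_multisetProd_mul_eq (hP : IsPauliFamily P) (γ δ : Multiset J) :
    ∃ s : ℝ, multisetProd P γ * multisetProd P δ = s • multisetProd P (γ + δ) := by
  have hperm : (γ.toList ++ δ.toList).Perm (γ + δ).toList := by
    rw [← Multiset.coe_eq_coe, ← Multiset.coe_add]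
    simp only [Multiset.coe_toList]
  simpa [multisetProd] using hP.exists_prod_eq_smul_of_perm hperm

/-- The algebra of the matrix-valued functions of `t : J → ℝ` spanned by the monomials in `t` with
coefficients the products of members of a Pauli family indexed by the same multiset. -/
def IsPauliFamily.monomialAlgebra (hP : IsPauliFamily P) :
    Subalgebra ℝ ((J → ℝ) → Matrix ι ι ℝ) :=
  (Submodule.span ℝ (Set.range fun (γ : Multiset J) (t : J → ℝ) =>
    (γ.map t).prod • multisetProd P γ)).toSubalgebra
    (Submodule.subset_span ⟨0, by ext; simp [multisetProd]⟩)
    fun F G hF hG => by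
      have hFG := Submodule.mul_mem_mul hF hG
      rw [Submodule.span_mul_span] at hFG
      refine Submodule.span_le.2 ?_ hFG
      rintro _ ⟨_, ⟨γ, rfl⟩, _, ⟨δ, rfl⟩, rfl⟩
      obtain ⟨s, hs⟩ := hP.exists_multisetProd_mul_eq γ δ
      have heq : ((fun t : J → ℝ => (γ.map t).prod • multisetProd P γ) *
          fun t => (δ.map t).prod • multisetProd P δ) =
          s • fun t => ((γ + δ).map t).prod • multisetProd P (γ + δ) := by
        funext t
        simp only [Pi.mul_apply, Pi.smul_apply, smul_mul_smul_comm, hs, Multiset.map_add,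
          Multiset.prod_add]
        rw [smul_comm]
      beta_reduce
      rw [heq]
      exact Submodule.smul_mem _ _ (Submodule.subset_span ⟨γ + δ, rfl⟩)

/-- The tuple with coordinates `c` in a family, the member `a` being scaled by `t a`. -/
def scaledTuple [Fintype J] (P : J → Matrix ι ι ℝ) (c : Fin g → J → ℝ) (t : J → ℝ) :
    Fin g → Matrix ι ι ℝ :=
  fun j => ∑ a, t a • c j a • P a

omit [Fintype ι] [DecidableEq ι] in
theorem scaledTuple_isSymm [Fintype J] {c : Fin g → J → ℝ} (hc : ∀ j a, (c j a • P a).IsSymm)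
    (t : J → ℝ) (j : Fin g) : (scaledTuple P c t j).IsSymm := by
  simp only [scaledTuple, IsSymm, transpose_sum]
  exact Finset.sum_congr rfl fun a _ => (hc j a).smul (t a)

theorem IsPauliFamily.evalOn_scaledTuple_mem_monomialAlgebra [Fintype J] (hP : IsPauliFamily P)
    (c : Fin g → J → ℝ) (h : Poly g) :
    (fun t => evalOn (scaledTuple P c t) h) ∈ hP.monomialAlgebra := by
  induction h using FreeAlgebra.induction with
  | grade0 r =>
    simp only [AlgHom.commutes]
    exact hP.monomialAlgebra.algebraMap_mem r
  | grade1 j =>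
    have heq : (fun t => evalOn (scaledTuple P c t) (FreeAlgebra.ι ℝ j)) =
        ∑ a, c j a • fun t : J → ℝ => (({a} : Multiset J).map t).prod • multisetProd P {a} := by
      ext t : 1
      rw [evalOn_ι, scaledTuple, Finset.sum_apply]
      refine Finset.sum_congr rfl fun a _ => ?_
      rw [smul_comm, Pi.smul_apply]
      simp [multisetProd]
    rw [heq]
    refine sum_mem fun a _ => hP.monomialAlgebra.smul_mem ?_ _
    exact Submodule.subset_span (Set.mem_range_self {a})
  | mul p q hp hq =>
    simp only [map_mul]
    exact mul_mem hp hq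
  | add p q hp hq =>
    simp only [map_add]
    exact add_mem hp hq

theorem exists_weight_injOn [Finite J] (s : Finset (Multiset J)) :
    ∃ W : J → ℕ, Set.InjOn (fun γ : Multiset J => (γ.map W).sum) s := by
  classical
  have := Fintype.ofFinite J
  let e := Fintype.equivFin J
  -- The multiplicities are the digits in base `B` of the total weight.
  let B := s.sup Multiset.card + 1
  refine ⟨fun a => B ^ (e a : ℕ), ?_⟩
  have hcount : ∀ γ ∈ s, ∀ a, γ.count a < B := fun γ hγ a =>
    Nat.lt_succ_of_le ((γ.count_le_card a).trans (Finset.le_sup (f := Multiset.card) hγ))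
  have hsum : ∀ γ (hγ : γ ∈ s), (γ.map fun a => B ^ (e a : ℕ)).sum =
      (finFunctionFinEquiv fun i => (⟨γ.count (e.symm i), hcount γ hγ _⟩ : Fin B) : ℕ) := by
    intro γ hγ
    rw [finFunctionFinEquiv_apply, Finset.sum_multiset_map_count,
      Finset.sum_subset (Finset.subset_univ _), ← e.symm.sum_comp]
    · simp
    · intro a _ ha
      rw [Multiset.mem_toFinset] at ha
      simp [ha]
  intro γ hγ δ hδ h
  beta_reduce at h
  rw [hsum γ hγ, hsum δ hδ] at h
  ext a
  simpa using congrArg Fin.val (congrFun (finFunctionFinEquiv.injective (Fin.ext h)) (e a))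

theorem exists_isUnit_sum_pow_smul {σ : Type*} {s : Finset σ} (hs : s.Nonempty) {w : σ → ℕ}
    (hw : Set.InjOn w s) {M : σ → Matrix ι ι ℝ} (hM : ∀ γ ∈ s, IsUnit (M γ)) :
    ∃ τ : ℝ, IsUnit (∑ γ ∈ s, τ ^ w γ • M γ) := by
  obtain ⟨γ₀, hγ₀, hmin⟩ := s.exists_min_image w hs
  -- After division by the lowest power of `τ` only the term of `γ₀` survives at `τ = 0`.
  let F : ℝ → Matrix ι ι ℝ := fun τ => ∑ γ ∈ s, τ ^ (w γ - w γ₀) • M γ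
  have hF0 : F 0 = M γ₀ := by
    refine (Finset.sum_eq_single γ₀ (fun γ hγ hne => ?_) fun h => absurd hγ₀ h).trans (by simp)
    have hlt : w γ₀ < w γ := (hmin γ hγ).lt_of_ne fun h => hne (hw hγ hγ₀ h.symm)
    rw [zero_pow (Nat.sub_ne_zero_of_lt hlt), zero_smul]
  have hF : ∀ τ, ∑ γ ∈ s, τ ^ w γ • M γ = τ ^ w γ₀ • F τ := fun τ => by
    rw [Finset.smul_sum]
    refine Finset.sum_congr rfl fun γ hγ => ?_
    rw [smul_smul, ← pow_add, Nat.add_sub_cancel' (hmin γ hγ)]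
  have hdet : ContinuousAt (fun τ => (F τ).det) 0 := by fun_prop
  have hdet0 : (F 0).det ≠ 0 := by
    rw [hF0]
    exact ((isUnit_iff_isUnit_det _).1 (hM γ₀ hγ₀)).ne_zero
  obtain ⟨τ, hτ, hτ0⟩ := ((eventually_nhdsWithin_of_eventually_nhds (s := {0}ᶜ)
    (hdet.eventually_ne hdet0)).and self_mem_nhdsWithin).exists
  refine ⟨τ, ?_⟩
  rw [hF, isUnit_iff_isUnit_det, det_smul]
  exact (mul_ne_zero (pow_ne_zero _ (pow_ne_zero _ hτ0)) hτ).isUnit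

theorem IsPauliFamily.exists_isUnit_evalOn_scaledTuple [Fintype J] (hP : IsPauliFamily P)
    {c : Fin g → J → ℝ} {t₀ : J → ℝ} {h : Poly g} (hne : evalOn (scaledTuple P c t₀) h ≠ 0) :
    ∃ t : J → ℝ, IsUnit (evalOn (scaledTuple P c t) h) := by
  obtain ⟨C, hC⟩ := Finsupp.mem_span_range_iff_exists_finsupp.1
    (hP.evalOn_scaledTuple_mem_monomialAlgebra c h)
  have heval : ∀ t : J → ℝ, evalOn (scaledTuple P c t) h =
      ∑ γ ∈ C.support, (γ.map t).prod • C γ • multisetProd P γ := fun t => by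
    rw [← congrFun hC t, Finsupp.sum, Finset.sum_apply]
    exact Finset.sum_congr rfl fun γ _ => smul_comm (C γ) (γ.map t).prod (multisetProd P γ)
  have hsupp : C.support.Nonempty := Finset.nonempty_iff_ne_empty.2 fun h0 =>
    hne (by rw [heval, h0, Finset.sum_empty])
  obtain ⟨W, hW⟩ := exists_weight_injOn C.support
  obtain ⟨τ, hτ⟩ := exists_isUnit_sum_pow_smul hsupp hW
    (M := fun γ => C γ • multisetProd P γ) fun γ hγ =>
      (hP.isUnit_multisetProd γ).smul (Units.mk0 (C γ) (Finsupp.mem_support_iff.1 hγ))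
  refine ⟨fun a => τ ^ W a, ?_⟩
  have hpow : ∀ γ : Multiset J, (γ.map fun a => τ ^ W a).prod = τ ^ (γ.map W).sum := fun γ => by
    induction γ using Multiset.induction with
    | empty => simp
    | cons a γ ih => simp [ih, pow_add]
  simpa only [heval, hpow] using hτ

end PauliFamily

section InvertibleValues

theorem evalOn_fromBlocks {ι κ : Type*} [Fintype ι] [DecidableEq ι] [Fintype κ] [DecidableEq κ]
    (X : Fin g → Matrix ι ι ℝ) (Y : Fin g → Matrix κ κ ℝ) (p : Poly g) :
    evalOn (fun j => fromBlocks (X j) 0 0 (Y j)) p =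
      fromBlocks (evalOn X p) 0 0 (evalOn Y p) := by
  induction p using FreeAlgebra.induction with
  | grade0 r => simp [Algebra.algebraMap_eq_smul_one, ← fromBlocks_one, fromBlocks_smul]
  | grade1 j => simp
  | mul p q hp hq => simp [hp, hq, fromBlocks_multiply]
  | add p q hp hq => simp [hp, hq, fromBlocks_add]

theorem exists_evalOn_ne_zero_of_card_le {h : Poly g} (hh : h ≠ 0) {ι : Type*} [Fintype ι]
    [DecidableEq ι] (hcard : Fintype.card (Words g (degree h)) ≤ Fintype.card ι) :
    ∃ X : Fin g → Matrix ι ι ℝ, (∀ j, (X j).IsSymm) ∧ evalOn X h ≠ 0 := by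
  set L := degree h
  obtain ⟨m, hm⟩ := Nat.exists_eq_add_of_le hcard
  let e : ι ≃ Words g L ⊕ Fin m := Fintype.equivOfCardEq (by simp [hm])
  refine ⟨fun j => (fromBlocks (fock g L j) 0 0 0).submatrix e e, fun j => ?_, fun h0 => hh ?_⟩
  · refine IsSymm.submatrix ?_ e
    rw [IsSymm, fromBlocks_transpose, (fock_isSymm g L j).eq]
    simp
  · have hfock : evalOn (fock g L) h = 0 := by
      rw [← submatrix_evalOn, evalOn_fromBlocks (fock g L) fun _ => 0] at h0
      ext a b
      simpa using congrFun (congrFun h0 (e.symm (Sum.inl a))) (e.symm (Sum.inl b))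
    exact isSeparating_fock g L h le_rfl (by rw [hfock, zero_mulVec])

theorem exists_isUnit_evalOn {h : Poly g} (hh : h ≠ 0) (N : ℕ) :
    ∃ n ≥ N, ∃ X : Fin g → Matrix (Fin n) (Fin n) ℝ, (∀ j, (X j).IsSymm) ∧
      IsUnit (evalOn X h) := by
  set k := max N (Fintype.card (Words g (degree h)))
  obtain ⟨ι, J, _, _, _, P, hP, hcard⟩ := exists_isPauliFamily_card_eq k
  have hk : k ≤ Fintype.card ι := by
    rw [hcard]
    exact (k.lt_succ_self.trans Nat.lt_two_pow_self).le
  obtain ⟨Y, hY, hne⟩ := exists_evalOn_ne_zero_of_card_le (ι := ι) hh ((le_max_right ..).trans hk)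
  choose c hc hYc using fun j => hP.exists_sum_smul_eq (hY j)
  have hYtuple : Y = scaledTuple P c fun _ => 1 := by
    ext1 j
    simp only [scaledTuple, one_smul, hYc]
  obtain ⟨t, ht⟩ := hP.exists_isUnit_evalOn_scaledTuple (hYtuple ▸ hne)
  let e := (Fintype.equivFin ι).symm
  refine ⟨Fintype.card ι, (le_max_left ..).trans hk,
    fun j => (scaledTuple P c t j).submatrix e e, fun j => (scaledTuple_isSymm hc t j).submatrix e,
    ?_⟩
  rw [← submatrix_evalOn]
  exact (isUnit_submatrix_equiv e e).2 ht

end InvertibleValues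

section Domination

/-- The homogeneous component of degree `d`. -/
def homogeneousPart (d : ℕ) (h : Poly g) : Poly g :=
  polyOf fun a : Words g d => if a.1.length = d then coef a.1 h else 0

theorem coef_homogeneousPart (d : ℕ) (h : Poly g) (l : List (Fin g)) :
    coef l (homogeneousPart d h) = if l.length = d then coef l h else 0 := by
  rw [homogeneousPart, coef_polyOf]
  split_ifs with hle hd hd
  · rfl
  · rfl
  · exact absurd hd.le hle
  · rfl

theorem homogeneousPart_degree_ne_zero {h : Poly g} (hh : h ≠ 0) :
    homogeneousPart (degree h) h ≠ 0 := fun h0 => by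
  obtain ⟨l, hl, hlen⟩ := exists_coef_ne_zero_length_eq_degree hh
  have hcoef := coef_homogeneousPart (degree h) h l
  rw [h0, map_zero, if_pos hlen] at hcoef
  exact hl hcoef.symm

variable {ι : Type*} [Fintype ι] [DecidableEq ι]

theorem evalOn_smul_word (t : ℝ) (X : Fin g → Matrix ι ι ℝ) (l : List (Fin g)) :
    evalOn (t • X) (word l) = t ^ l.length • evalOn X (word l) := by
  induction l with
  | nil => simp
  | cons j l ih => simp [ih, pow_succ, smul_smul]

theorem exists_scaled_evalOn (X : Fin g → Matrix ι ι ℝ) (h : Poly g) :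
    ∃ R : ℝ → Matrix ι ι ℝ, Continuous R ∧ R 0 = evalOn X (homogeneousPart (degree h) h) ∧
      ∀ s ≠ 0, R s = s ^ degree h • evalOn (s⁻¹ • X) h := by
  refine ⟨fun s => ∑ a : Words g (degree h),
    s ^ (degree h - a.1.length) • coef a.1 h • evalOn X (word a.1), by fun_prop, ?_,
    fun s hs => ?_⟩
  · rw [homogeneousPart, polyOf_apply, map_sum]
    refine Finset.sum_congr rfl fun a _ => ?_
    rw [map_smul]
    split_ifs with hd
    · rw [hd, Nat.sub_self, pow_zero, one_smul]
    · rw [zero_pow (Nat.sub_ne_zero_of_lt (a.2.lt_of_ne hd)), zero_smul, zero_smul]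
  · rw [← sum_coef_smul_evalOn_word (s⁻¹ • X) le_rfl, Finset.smul_sum]
    refine Finset.sum_congr rfl fun a _ => ?_
    rw [evalOn_smul_word, smul_comm (coef a.1 h), pow_sub₀ s hs a.2, inv_pow, mul_smul]

theorem posSemidef_evalOn_star_mul_self {X : Fin g → Matrix ι ι ℝ} (hX : ∀ j, (X j).IsSymm)
    (q : Poly g) : (evalOn X (star q * q)).PosSemidef := by
  rw [map_mul, evalOn_star hX, ← conjTranspose_eq_transpose_of_trivial]
  exact posSemidef_conjTranspose_mul_self _

theorem eventually_posDef_add_star_mul_self {h : Poly g} (hd : degree h ≠ 0)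
    {X : Fin g → Matrix ι ι ℝ} (hX : ∀ j, (X j).IsSymm)
    (hu : IsUnit (evalOn X (homogeneousPart (degree h) h))) {B : Matrix ι ι ℝ} (hB : B.IsSymm) :
    ∀ᶠ s : ℝ in 𝓝[≠] 0, (B + evalOn (s⁻¹ • X) (star h * h)).PosDef := by
  obtain ⟨R, hRc, hR0, hR⟩ := exists_scaled_evalOn X h
  let G : ℝ → Matrix ι ι ℝ := fun s => s ^ (2 * degree h) • B + (R s)ᵀ * R s
  have hGsymm : ∀ s, (G s).IsSymm := fun s => by simp [G, IsSymm, hB.eq]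
  have hG0 : (G 0).PosDef := by
    simp only [G, zero_pow (mul_ne_zero two_ne_zero hd), zero_smul, zero_add, hR0]
    rw [← conjTranspose_eq_transpose_of_trivial]
    exact PosDef.conjTranspose_mul_self _ (mulVec_injective_of_isUnit hu)
  have hev := eventually_posDef hGsymm (by fun_prop) hG0
  filter_upwards [eventually_nhdsWithin_of_eventually_nhds hev, self_mem_nhdsWithin] with s hs hs0
  have h2d : 0 < s ^ (2 * degree h) := by
    rw [pow_mul]
    exact pow_pos (sq_pos_of_ne_zero hs0) _
  have hGs : (s ^ (2 * degree h))⁻¹ • G s = B + evalOn (s⁻¹ • X) (star h * h) := by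
    rw [map_mul, evalOn_star (X := s⁻¹ • X) fun j => (hX j).smul s⁻¹]
    simp only [G, hR s hs0]
    rw [transpose_smul, smul_mul_smul_comm, ← pow_add, ← two_mul, ← smul_add,
      inv_smul_smul₀ h2d.ne']
  exact hGs ▸ hs.smul (inv_pos.2 h2d)

theorem eventually_posDef_add_sum_star_mul_self {m : ℕ} (h : Fin m → Poly g) {k : Fin m}
    (hd : degree (h k) ≠ 0) {X : Fin g → Matrix ι ι ℝ} (hX : ∀ j, (X j).IsSymm)
    (hu : IsUnit (evalOn X (homogeneousPart (degree (h k)) (h k)))) {B : Matrix ι ι ℝ}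
    (hB : B.IsSymm) :
    ∀ᶠ s : ℝ in 𝓝[≠] 0, (B + evalOn (s⁻¹ • X) (∑ j, star (h j) * h j)).PosDef := by
  filter_upwards [eventually_posDef_add_star_mul_self hd hX hu hB] with s hs
  rw [← Finset.add_sum_erase _ _ (Finset.mem_univ k), map_add, ← add_assoc, map_sum]
  exact hs.add_posSemidef (posSemidef_sum _ fun j _ =>
    posSemidef_evalOn_star_mul_self (fun i => (hX i).smul s⁻¹) _)

end Domination

section NegativeSquares

theorem eq_coef_nil_smul_one {h : Poly g} (hd : degree h = 0) : h = coef [] h • 1 := by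
  refine poly_ext fun l => ?_
  rw [map_smul, ← word_nil, coef_word]
  split_ifs with hl
  · simp [hl]
  · rw [smul_zero, coef_eq_zero_of_degree_lt (by rw [hd]; exact List.length_pos_iff.2 hl)]

theorem exists_degree_ne_zero_of_sum_star_mul_self {m : ℕ} {h : Fin m → Poly g}
    (h0 : coef [] (∑ j, star (h j) * h j) = 0) (hne : ∑ j, star (h j) * h j ≠ 0) :
    ∃ k, degree (h k) ≠ 0 := by
  by_contra! hd
  have hsum : ∑ j, star (h j) * h j = (∑ j, coef [] (h j) * coef [] (h j)) • (1 : Poly g) := by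
    rw [Finset.sum_smul]
    refine Finset.sum_congr rfl fun j _ => ?_
    conv_lhs => rw [eq_coef_nil_smul_one (hd j)]
    rw [star_smul_poly, star_one, smul_mul_smul_comm, mul_one]
  refine hne ?_
  rw [hsum, map_smul, ← word_nil, coef_word, if_pos rfl, smul_eq_mul, mul_one] at h0
  rw [hsum, h0, zero_smul]

theorem not_convex_levelSet_of_isHermitianSOS_neg {p : Poly g} (hp0 : coef [] p = 0)
    (hsos : IsHermitianSOS (-p)) (hne : p ≠ 0) (N : ℕ) :
    ∃ n ≥ N, ∀ B : Matrix (Fin n) (Fin n) ℝ, B.IsSymm → ¬ B.PosSemidef →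
      ¬ Convex ℝ (levelSet p B) := by
  obtain ⟨m, h, hh⟩ := hsos
  obtain ⟨k, hk⟩ := exists_degree_ne_zero_of_sum_star_mul_self (h := h)
    (by rw [← hh, map_neg, hp0, neg_zero]) (by rw [← hh]; exact neg_ne_zero.2 hne)
  have hhk : h k ≠ 0 := fun h0 => hk (by simp [h0, degree])
  obtain ⟨n, hn, X, hX, hu⟩ := exists_isUnit_evalOn (homogeneousPart_degree_ne_zero hhk) N
  refine ⟨n, hn, fun B hB hBneg hconv => hBneg ?_⟩
  have hmem : ∀ᶠ s : ℝ in 𝓝[≠] 0, s⁻¹ • X ∈ levelSet p B := by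
    filter_upwards [eventually_posDef_add_sum_star_mul_self h hk hX hu hB] with s hs
    refine ⟨fun j => (hX j).smul s⁻¹, ?_⟩
    rwa [← hh, map_neg, ← sub_eq_add_neg] at hs
  have hneg : Tendsto (fun s : ℝ => -s) (𝓝[≠] 0) (𝓝[≠] 0) :=
    tendsto_nhdsWithin_iff.2
      ⟨tendsto_nhdsWithin_of_tendsto_nhds (continuous_neg.tendsto' 0 0 neg_zero),
        eventually_mem_nhdsWithin.mono fun s => neg_ne_zero.2⟩
  obtain ⟨s, hs, hs'⟩ := (hmem.and (hneg.eventually hmem)).exists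
  have hmid : midpoint ℝ (s⁻¹ • X) ((-s)⁻¹ • X) = 0 := by
    rw [inv_neg, neg_smul, midpoint_self_neg]
  have hzero : (0 : Fin g → Matrix (Fin n) (Fin n) ℝ) ∈ levelSet p B :=
    hmid ▸ hconv.midpoint_mem hs hs'
  have heval : evalOn (0 : Fin g → Matrix (Fin n) (Fin n) ℝ) p = 0 := by
    rw [evalOn_zero, hp0, zero_smul]
  have hposDef : (B - evalOn 0 p).PosDef := hzero.2
  rw [heval, sub_zero] at hposDef
  exact hposDef.posSemidef

end NegativeSquares

end FreePoly

end

theorem theorem1p1 (g : ℕ) (p : FreePoly.Poly g) (hp : FreePoly.IsQuasiConvex p) :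
    (FreePoly.IsHermitianSOS (-p) ∨
      (FreePoly.degree p ≤ 2 ∧
        ∃ (l : FreePoly.Poly g) (m : ℕ) (s : Fin m → FreePoly.Poly g),
          FreePoly.IsLinear l ∧ (∀ j, FreePoly.IsLinear (s j)) ∧
            p = l + ∑ j, star (s j) * s j)) ∧
    ((∃ N : ℕ, ∀ n : ℕ, N ≤ n →
        ∃ B : Matrix (Fin n) (Fin n) ℝ,
          B.IsSymm ∧ ¬ B.PosSemidef ∧ Convex ℝ (FreePoly.levelSet p B)) →
      (FreePoly.IsHermitianSOS (-p) ↔ p = 0)) := by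
  refine ⟨hp.isHermitianSOS_neg_or_eq_linear_add_squares, fun ⟨N, hN⟩ => ⟨fun hsos => ?_, ?_⟩⟩
  · by_contra hne
    obtain ⟨n, hn, hconv⟩ :=
      FreePoly.not_convex_levelSet_of_isHermitianSOS_neg hp.coef_nil hsos hne N
    obtain ⟨B, hB, hBneg, hBconv⟩ := hN n hn
    exact hconv B hB hBneg hBconv
  · rintro rfl
    exact ⟨0, Fin.elim0, by simp⟩
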